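/- Let $n\ge 2$, $W=\mathbb R^{n-1}$ with Lebesgue measure $dx$, and let $G=O(n,1)$ be the group of real $(n+1)\times(n+1)$ matrices preserving the form $x_1^2+\dots+x_{n-1}^2-2x_0x_n$ on $\mathbb R^{n+1}$. Let $K=G\cap O(n+1)$ with a fixed Haar measure $dk$. For $x\in W$ (a row vector) and $a\in\mathbb R^*$ put $$u(x)=\begin{pmatrix}1&x&|x|^2/2\\0&1_{n-1}&{}^tx\\0&0&1\end{pmatrix},\qquad d(a)=\mathrm{diag}(a,1_{n-1},a^{-1}),$$ let $N=\{u(x)\}$, $A=\{d(a)\}$, let $M$ be the centralizer of $A$ in $K$, let $w\in G$ be the matrix exchanging $e_0$ and $e_n$ and fixing $e_1,\dots,e_{n-1}$, and put $\rho_P(d(a))=|a|^{(n-1)/2}$. For real $u$ let $\mathcal F_u$ be the space of continuous functions $f:G\to\mathbb C$ with $f(g\,m\,a\,\nu)=f(g)\,\rho_P(a)^{-(1+u)}$ for all $g\in G$, $m\in M$, $a\in A$, $\nu\in N$. For $f\in\mathcal F_u$ and $h\in\mathcal F_{-u}$ put $\langle f,h\rangle=\int_K\overline{f(k)}\,h(k)\,dk$.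 **Theorem.** Let $0<u<1$. Every Schwartz function $\phi\in\mathcal S(W)$ extends uniquely to an element of $\mathcal F_u$, again written $\phi$, such that $\phi(u(x)w)=\phi(x)$ for all $x\in W$. For it the integral $$(I(u)\phi)(g)=\int_W\phi(g\,u(x)\,w)\,dx$$ converges absolutely for every $g\in G$ and defines an element $I(u)\phi$ of $\mathcal F_{-u}$. There is a constant $c>0$, depending only on $u$ (and on the fixed data $n$ and $dk$), such that for all $\phi\in\mathcal S(W)$ $$\langle\phi,I(u)\phi\rangle=c\int_W|\widehat\phi(x)|^2\,\frac{1}{|x|^{(n-1)u}}\,dx ,$$ where $\widehat\phi(x)=\int_W\phi(y)e^{-2\pi i\,x\cdot y}\,dy$ and the integral on the right converges. In particular the pairing is positive definite on $\mathcal S(W)$: $\langle\phi,I(u)\phi\rangle$ is a positive real number for every nonzero $\phi\in\mathcal S(W)$. -/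

import Mathlib

open MeasureTheory Matrix
open scoped FourierTransform SchwartzMap ComplexConjugate

namespace ComplementarySeries

/-- The index set `0, 1, …, n-1, n` of the coordinates of `ℝ^{n+1}`, split as
`{0} ⊔ {1, …, n-1} ⊔ {n}`. -/
inductive Idx (n : ℕ) : Type
  | zero : Idx n
  | mid (i : Fin (n - 1)) : Idx n
  | last : Idx n

/-- `Idx n` is the disjoint union of two points and of `Fin (n - 1)`. -/
def Idx.equiv (n : ℕ) : Idx n ≃ Option (Option (Fin (n - 1))) where
  toFun
    | .zero => none
    | .last => some none
    | .mid i => some (some i)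
  invFun
    | none => .zero
    | some none => .last
    | some (some i) => .mid i
  left_inv := by rintro (_ | _ | _) <;> rfl
  right_inv := by rintro (_ | _ | _) <;> rfl

instance (n : ℕ) : DecidableEq (Idx n) := (Idx.equiv n).decidableEq

instance (n : ℕ) : Fintype (Idx n) := Fintype.ofEquiv _ (Idx.equiv n).symm

theorem Idx.sum_eq {n : ℕ} (f : Idx n → ℝ) :
    ∑ i, f i = f .zero + (∑ i, f (.mid i)) + f .last := by
  rw [← (Idx.equiv n).symm.sum_comp, Fintype.sum_option, Fintype.sum_option]
  simp only [Idx.equiv, Equiv.coe_fn_symm_mk]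
  ring

/-- The Euclidean space `W = ℝ^{n-1}`. -/
abbrev W (n : ℕ) : Type := EuclideanSpace ℝ (Fin (n - 1))

/-- The Gram matrix of the quadratic form `x_1 ^ 2 + ⋯ + x_{n-1} ^ 2 - 2 x_0 x_n`
of signature `(n, 1)` on `ℝ^{n+1}`. -/
def gram (n : ℕ) : Matrix (Idx n) (Idx n) ℝ := Matrix.of fun
  | .zero, .last => -1
  | .last, .zero => -1
  | .mid i, .mid j => if i = j then 1 else 0
  | _, _ => 0

/-- The group `G = O(n,1)` of all real matrices preserving the form `gram n`. It carries the
topology induced from `GL(n+1, ℝ)`. -/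
def G (n : ℕ) : Subgroup (GL (Idx n) ℝ) where
  carrier := {g | (g : Matrix (Idx n) (Idx n) ℝ)ᵀ * gram n * (g : Matrix (Idx n) (Idx n) ℝ)
    = gram n}
  one_mem' := by simp
  mul_mem' := by
    intro a b ha hb
    simp only [Set.mem_ofPred_eq, Units.val_mul, Matrix.transpose_mul] at *
    calc _ = (b : Matrix (Idx n) (Idx n) ℝ)ᵀ * ((a : Matrix (Idx n) (Idx n) ℝ)ᵀ * gram n *
          (a : Matrix (Idx n) (Idx n) ℝ)) * (b : Matrix (Idx n) (Idx n) ℝ) := by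
          simp only [Matrix.mul_assoc]
      _ = _ := by rw [ha, hb]
  inv_mem' := by
    intro a ha
    simp only [Set.mem_ofPred_eq] at *
    have h1 : (a : Matrix (Idx n) (Idx n) ℝ) * ((a⁻¹ : GL (Idx n) ℝ) : Matrix (Idx n) (Idx n) ℝ)
        = 1 := by
      rw [← Units.val_mul, mul_inv_cancel, Units.val_one]
    have h2 : ((a⁻¹ : GL (Idx n) ℝ) : Matrix (Idx n) (Idx n) ℝ)ᵀ *
        (a : Matrix (Idx n) (Idx n) ℝ)ᵀ = 1 := by
      rw [← Matrix.transpose_mul, h1, Matrix.transpose_one]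
    calc _ = ((a⁻¹ : GL (Idx n) ℝ) : Matrix (Idx n) (Idx n) ℝ)ᵀ *
          ((a : Matrix (Idx n) (Idx n) ℝ)ᵀ * gram n * (a : Matrix (Idx n) (Idx n) ℝ)) *
          ((a⁻¹ : GL (Idx n) ℝ) : Matrix (Idx n) (Idx n) ℝ) := by rw [ha]
      _ = (((a⁻¹ : GL (Idx n) ℝ) : Matrix (Idx n) (Idx n) ℝ)ᵀ *
          (a : Matrix (Idx n) (Idx n) ℝ)ᵀ) * gram n * ((a : Matrix (Idx n) (Idx n) ℝ) *
          ((a⁻¹ : GL (Idx n) ℝ) : Matrix (Idx n) (Idx n) ℝ)) := by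
          simp only [Matrix.mul_assoc]
      _ = gram n := by rw [h1, h2, Matrix.one_mul, Matrix.mul_one]

/-- The matrix `u(x)`: first row `(1, x, |x|²/2)`, then `(0, 1_{n-1}, xᵗ)`, then `(0, 0, 1)`. -/
noncomputable def uMat {n : ℕ} (x : W n) : Matrix (Idx n) (Idx n) ℝ := Matrix.of fun
  | .zero, .zero => 1
  | .zero, .mid j => x j
  | .zero, .last => ‖x‖ ^ 2 / 2
  | .mid i, .mid j => if i = j then 1 else 0
  | .mid i, .last => x i
  | .last, .last => 1
  | _, _ => 0

/-- The matrix `w` exchanging the basis vectors `e_0` and `e_n` and fixing the other ones. -/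
def wMat (n : ℕ) : Matrix (Idx n) (Idx n) ℝ := Matrix.of fun
  | .zero, .last => 1
  | .last, .zero => 1
  | .mid i, .mid j => if i = j then 1 else 0
  | _, _ => 0

/-- The diagonal matrix `d(a) = diag(a, 1, …, 1, a⁻¹)`. -/
noncomputable def dMat (n : ℕ) (a : ℝ) : Matrix (Idx n) (Idx n) ℝ := Matrix.diagonal fun
  | .zero => a
  | .mid _ => 1
  | .last => a⁻¹

theorem uMat_mul_neg {n : ℕ} (x : W n) : uMat x * uMat (-x) = 1 := by
  ext i j
  rw [Matrix.mul_apply, Idx.sum_eq, Matrix.one_apply]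
  cases i <;> cases j <;>
    simp [uMat, EuclideanSpace.norm_sq_eq, Real.norm_eq_abs, ← pow_two]
  ring

theorem wMat_mul_self (n : ℕ) : wMat n * wMat n = 1 := by
  ext i j
  rw [Matrix.mul_apply, Idx.sum_eq, Matrix.one_apply]
  cases i <;> cases j <;> simp [wMat]

theorem dMat_mul_inv (n : ℕ) {a : ℝ} (ha : a ≠ 0) : dMat n a * dMat n a⁻¹ = 1 := by
  rw [dMat, dMat, Matrix.diagonal_mul_diagonal, ← Matrix.diagonal_one]
  congr 1
  ext i
  cases i <;> simp [ha]

/-- The element `u(x)` of `G`; the image of `u` is the subgroup `N`. -/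
noncomputable def unip {n : ℕ} (x : W n) : G n :=
  ⟨⟨uMat x, uMat (-x), uMat_mul_neg x, by simpa using uMat_mul_neg (-x)⟩, by
    change (uMat x)ᵀ * gram n * uMat x = gram n
    ext i j
    rw [Matrix.mul_apply, Idx.sum_eq]
    simp only [Matrix.mul_apply, Idx.sum_eq]
    cases i <;> cases j <;>
      simp [uMat, gram, EuclideanSpace.norm_sq_eq, Real.norm_eq_abs, ← pow_two, eq_comm]
    ring⟩

/-- The element `w` of `G`, which represents the nontrivial Weyl group element. -/
def weyl (n : ℕ) : G n :=
  ⟨⟨wMat n, wMat n, wMat_mul_self n, wMat_mul_self n⟩, by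
    change (wMat n)ᵀ * gram n * wMat n = gram n
    ext i j
    rw [Matrix.mul_apply, Idx.sum_eq]
    simp only [Matrix.mul_apply, Idx.sum_eq]
    cases i <;> cases j <;> simp [wMat, gram, eq_comm]⟩

/-- The element `d(a)` of `G`, `a ∈ ℝ^*`; the image of `d` is the subgroup `A`. -/
noncomputable def dia (n : ℕ) (a : ℝˣ) : G n :=
  ⟨⟨dMat n a, dMat n (a : ℝ)⁻¹, dMat_mul_inv n a.ne_zero, by
      simpa using dMat_mul_inv n (inv_ne_zero a.ne_zero)⟩, by
    change (dMat n a)ᵀ * gram n * dMat n a = gram n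
    ext i j
    rw [dMat, Matrix.diagonal_transpose, Matrix.mul_diagonal, Matrix.diagonal_mul]
    cases i <;> cases j <;> simp [gram]⟩

/-- The maximal compact subgroup `K = G ∩ O(n+1)` of `G`, isomorphic to `O(n) × O(1)`. -/
def K (n : ℕ) : Subgroup (G n) where
  carrier := {g | ((g : GL (Idx n) ℝ) : Matrix (Idx n) (Idx n) ℝ) ∈
    Matrix.orthogonalGroup (Idx n) ℝ}
  one_mem' := by simp
  mul_mem' := by
    intro a b ha hb
    exact (Matrix.orthogonalGroup (Idx n) ℝ).mul_mem ha hb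
  inv_mem' := by
    intro a ha
    simp only [Set.mem_ofPred_eq, Matrix.mem_orthogonalGroup_iff, Subgroup.coe_inv] at *
    have h : (((a : GL (Idx n) ℝ)⁻¹ : GL (Idx n) ℝ) : Matrix (Idx n) (Idx n) ℝ)
        = ((a : GL (Idx n) ℝ) : Matrix (Idx n) (Idx n) ℝ)ᵀ :=
      Units.inv_eq_of_mul_eq_one_right ha
    rw [h, Matrix.transpose_transpose]
    exact mul_eq_one_comm.mp ha

instance (n : ℕ) : MeasurableSpace (K n) := borel _

instance (n : ℕ) : BorelSpace (K n) := ⟨rfl⟩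

/-- The maximal compact subgroup `M` of the centralizer of `A` in `G`: the elements of `K` that
commute with `A`, i.e. the matrices `diag(±1, m, ±1)` with `m ∈ O(n-1)` and equal signs. -/
def M (n : ℕ) : Subgroup (G n) := K n ⊓ Subgroup.centralizer (Set.range (dia n))

/-- `ρ_P(d(a)) = |a|^{(n-1)/2}`, the square root of the modulus of the determinant of `Ad(d(a))`
on the Lie algebra of `N`. -/
noncomputable def rhoP (n : ℕ) (a : ℝˣ) : ℝ := |(a : ℝ)| ^ (((n : ℝ) - 1) / 2)

/-- The space `F_u` of all continuous functions `f` on `G` with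
`f(g m a n) = f(g) ρ_P(a)^{-(1+u)}` for `g ∈ G`, `m ∈ M`, `a ∈ A`, `n ∈ N`. -/
def F (n : ℕ) (u : ℝ) : Submodule ℂ (G n → ℂ) where
  carrier := {f | Continuous f ∧ ∀ (g : G n), ∀ m ∈ M n, ∀ (a : ℝˣ) (y : W n),
    f (g * m * dia n a * unip y) = f g * ((rhoP n a ^ (-(1 + u)) : ℝ) : ℂ)}
  zero_mem' := ⟨continuous_zero, by simp⟩
  add_mem' := by
    rintro f h ⟨hf, hf'⟩ ⟨hh, hh'⟩
    refine ⟨hf.add hh, fun g m hm a y => ?_⟩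
    simp only [Pi.add_apply, hf' g m hm a y, hh' g m hm a y, add_mul]
  smul_mem' := by
    rintro c f ⟨hf, hf'⟩
    refine ⟨hf.const_smul c, fun g m hm a y => ?_⟩
    rw [Pi.smul_apply, Pi.smul_apply, hf' g m hm a y, smul_eq_mul, smul_eq_mul, mul_assoc]

/-- `f` is the Schwartz function `φ` viewed as an element of `F_u`: it lies in `F_u`, and its
restriction to the big Bruhat cell is `φ`, i.e. `f(u(x) w) = φ(x)` for all `x ∈ W`. -/
def IsSectionOf {n : ℕ} (u : ℝ) (φ : 𝓢(W n, ℂ)) (f : G n → ℂ) : Prop :=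
  f ∈ F n u ∧ ∀ x : W n, f (unip x * weyl n) = φ x

/-- The intertwining integral `(I f)(g) = ∫_W f(g u(x) w) dx`. -/
noncomputable def intertwining {n : ℕ} (f : G n → ℂ) : G n → ℂ :=
  fun g => ∫ x : W n, f (g * unip x * weyl n)

/-- The pairing `⟨f, h⟩ = ∫_K conj (f(k)) h(k) dk`, `dk` a Haar measure on `K`. -/
noncomputable def pairing {n : ℕ} (dk : Measure (K n)) (f h : G n → ℂ) : ℂ :=
  ∫ k : K n, conj (f k) * h k ∂dk

end ComplementarySeries

/-! The group acts on the light cone through the first column `col g`, that is `g e_0`, and `M A N`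
is the stabilizer of the line of `e_0`. So an element of `F n t` is an even function on the cone,
homogeneous of degree `-weight n t`, where `weight n t = (1 + t)(n - 1)/2`
(`IsEquivariant.eq_of_col`, `isEquivariant_of_col`). The big cell is the set of cone vectors with
nonzero last coordinate, and `u(x) w` gives `(|x|²/2, x, 1)`. A Schwartz function therefore extends
by homogeneity; its decay makes the extension continuous by zero at the missing line, and density of
the cell gives uniqueness.

Elements of `F n t` are bounded by a power of the size of the cone vector, so for `t > 0` the
intertwining integral is dominated by `(1 + |x|²/2)^(-weight n t)`. Changes of variable under `N`,
`A` and `M` then give the equivariance of `I f`.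

For the pairing, `conj f * I f` lies in `F n 1`. On `F n 1` the integral over `K` is a constant
times the integral over `W` (`exists_integral_K_eq`), because `I` maps `F n 1` to constants. Since
`w` acts on `W` by the inversion `x ↦ 2x/|x|²`, `I f` restricted to the big cell is convolution of
`φ` with `(2/|y|²)^w`, where now `w = weight n (-u) = (1 - u)(n - 1)/2`.

It remains to see that the Fourier transform of `|y|^(-2w)` on a space of dimension `d` is a
positive multiple of `|ξ|^(2w - d)` (`exists_integral_corr_riesz`). The power is written as a
superposition of Gaussians by the Gamma integral, Parseval is applied to each Gaussian, and the
superposition is summed again on the Fourier side. Here `d - 2w = (n - 1)u`. Positivity follows from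
injectivity of the Fourier transform. -/

namespace ComplementarySeries

/-! ### Matrix identities, the light cone, and the stabilizer of the line of `e_0` -/

variable {n : ℕ}

/-- The matrix underlying an element of `G`. -/
def mat (g : G n) : Matrix (Idx n) (Idx n) ℝ := ((g : GL (Idx n) ℝ) : Matrix (Idx n) (Idx n) ℝ)

theorem mat_injective : Function.Injective (mat (n := n)) := fun _ _ h =>
  Subtype.ext (Units.ext h)

@[simp] theorem mat_one : mat (1 : G n) = 1 := rfl
@[simp] theorem mat_mul (g h : G n) : mat (g * h) = mat g * mat h := rfl
@[simp] theorem mat_unip (x : W n) : mat (unip x) = uMat x := rfl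
@[simp] theorem mat_weyl : mat (weyl n) = wMat n := rfl
@[simp] theorem mat_dia (a : ℝˣ) : mat (dia n a) = dMat n a := rfl

theorem mat_transpose_mul (g : G n) : (mat g)ᵀ * gram n * mat g = gram n := g.2

theorem gram_mul_self : gram n * gram n = 1 := by
  ext i j
  rw [Matrix.mul_apply, Idx.sum_eq, Matrix.one_apply]
  cases i <;> cases j <;> simp [gram]

theorem gram_transpose : (gram n)ᵀ = gram n := by
  ext i j
  cases i <;> cases j <;> simp [gram, eq_comm]

/-- Makes inversion polynomial in the entries, so that the topology of `G n` is the one induced by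
the matrix entries alone. -/
theorem mat_inv (g : G n) : mat g⁻¹ = gram n * (mat g)ᵀ * gram n := by
  have h1 : gram n * (mat g)ᵀ * gram n * mat g = 1 := by
    rw [Matrix.mul_assoc, Matrix.mul_assoc, ← Matrix.mul_assoc _ (gram n), mat_transpose_mul,
      gram_mul_self]
  have h2 : mat g * mat g⁻¹ = 1 := by rw [← mat_mul, mul_inv_cancel, mat_one]
  calc mat g⁻¹ = (gram n * (mat g)ᵀ * gram n * mat g) * mat g⁻¹ := by rw [h1, Matrix.one_mul]
    _ = _ := by rw [Matrix.mul_assoc, h2, Matrix.mul_one]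

theorem mat_mul_transpose (g : G n) : mat g * gram n * (mat g)ᵀ = gram n := by
  have h := mat_transpose_mul g⁻¹
  have h2 : mat g * mat g⁻¹ = 1 := by rw [← mat_mul, mul_inv_cancel, mat_one]
  rw [mat_inv] at h2
  calc mat g * gram n * (mat g)ᵀ
      = (mat g * (gram n * (mat g)ᵀ * gram n)) * gram n := by
        simp only [Matrix.mul_assoc, gram_mul_self, Matrix.mul_one]
    _ = _ := by rw [h2, Matrix.one_mul]

theorem gram_sandwich (A : Matrix (Idx n) (Idx n) ℝ) (j k : Idx n) :
    (Aᵀ * gram n * A) j k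
      = -(A .zero j * A .last k) - A .last j * A .zero k + ∑ i, A (.mid i) j * A (.mid i) k := by
  rw [Matrix.mul_apply, Idx.sum_eq]
  simp only [Matrix.mul_apply, Idx.sum_eq]
  simp [gram]
  ring

theorem col_form (g : G n) (j k : Idx n) :
    -(mat g .zero j * mat g .last k) - mat g .last j * mat g .zero k
      + ∑ i, mat g (.mid i) j * mat g (.mid i) k = gram n j k := by
  rw [← gram_sandwich, mat_transpose_mul]

theorem row_form (g : G n) (j k : Idx n) :
    -(mat g j .zero * mat g k .last) - mat g j .last * mat g k .zero
      + ∑ i, mat g j (.mid i) * mat g k (.mid i) = gram n j k := by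
  have := gram_sandwich (mat g)ᵀ j k
  rw [Matrix.transpose_transpose, mat_mul_transpose] at this
  rw [this]
  rfl

theorem mem_K_of_commute {g : G n} (h : mat g * gram n = gram n * mat g) : g ∈ K n := by
  change mat g ∈ Matrix.orthogonalGroup (Idx n) ℝ
  rw [Matrix.mem_orthogonalGroup_iff']
  have := mat_transpose_mul g
  rw [Matrix.mul_assoc, ← h, ← Matrix.mul_assoc] at this
  calc (mat g)ᵀ * mat g = ((mat g)ᵀ * mat g * gram n) * gram n := by
        rw [Matrix.mul_assoc, gram_mul_self, Matrix.mul_one]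
    _ = 1 := by rw [this, gram_mul_self]

/-- The first column `g e_0` of `g`, a point of the light cone. -/
def col (g : G n) : Idx n → ℝ := fun i => mat g i .zero

theorem col_mul (g h : G n) : col (g * h) = mat g *ᵥ col h := by
  ext i
  simp [col, Matrix.mul_apply, Matrix.mulVec, dotProduct]

theorem mulVec_eq (A : Matrix (Idx n) (Idx n) ℝ) (v : Idx n → ℝ) (i : Idx n) :
    (A *ᵥ v) i = A i .zero * v .zero + ∑ j, A i (.mid j) * v (.mid j) + A i .last * v .last := by
  simp [Matrix.mulVec, dotProduct, Idx.sum_eq]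

/-- The vector `e_0` is isotropic and `g` preserves the form: this is the equation of the light
cone. -/
theorem sum_col_sq (g : G n) : ∑ i, col g (.mid i) ^ 2 = 2 * col g .zero * col g .last := by
  have h := col_form g .zero .zero
  have h0 : gram n .zero .zero = 0 := rfl
  simp only [h0, ← pow_two] at h
  simp only [col]
  linarith

theorem mem_M_of_block {m : G n} (h00 : mat m .zero .zero = 1) (hnn : mat m .last .last = 1)
    (h1 : ∀ i, mat m (.mid i) .zero = 0) (h2 : mat m .last .zero = 0)
    (h3 : ∀ i, mat m .zero (.mid i) = 0) (h4 : ∀ i, mat m .last (.mid i) = 0)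
    (h5 : mat m .zero .last = 0) (h6 : ∀ i, mat m (.mid i) .last = 0) : m ∈ M n := by
  refine ⟨mem_K_of_commute ?_, ?_⟩
  · ext i j
    simp only [Matrix.mul_apply, Idx.sum_eq]
    cases i <;> cases j <;> simp [gram, h00, hnn, h1, h2, h3, h4, h5, h6]
  · refine Subgroup.mem_centralizer_iff.mpr ?_
    rintro _ ⟨a, rfl⟩
    apply mat_injective
    rw [mat_mul, mat_mul, mat_dia, dMat]
    ext i j
    rw [Matrix.diagonal_mul, Matrix.mul_diagonal]
    cases i <;> cases j <;> simp [h00, hnn, h1, h2, h3, h4, h5, h6]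

theorem col_unip_mul_weyl (x : W n) :
    col (unip x * weyl n) = fun
      | .zero => ‖x‖ ^ 2 / 2
      | .mid i => x i
      | .last => 1 := by
  ext i
  simp only [col, mat_mul, Matrix.mul_apply, Idx.sum_eq]
  cases i <;> simp [uMat, wMat]

theorem mulVec_unip_col (p : G n) (y : W n) (i : Idx n) :
    mat (p * unip y) i .zero = mat p i .zero := by
  simp only [mat_mul, Matrix.mul_apply, Idx.sum_eq]
  simp [uMat]

theorem mat_mul_unip_mid (p : G n) (y : W n) (i : Idx n) (j : Fin (n - 1)) :
    mat (p * unip y) i (.mid j) = mat p i .zero * y j + mat p i (.mid j) := by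
  simp only [mat_mul, Matrix.mul_apply, Idx.sum_eq]
  simp [uMat]

theorem mat_mul_dia (p : G n) (a : ℝˣ) (i j : Idx n) :
    mat (p * dia n a) i j = mat p i j * (match j with
      | .zero => (a : ℝ)
      | .mid _ => 1
      | .last => (a : ℝ)⁻¹) := by
  refine (Matrix.mul_diagonal _ _ _ _).trans ?_
  cases j <;> rfl

/-- The stabilizer of the line spanned by `e_0` is `M A N`. -/
theorem exists_eq_of_col {p : G n} (a : ℝˣ) (h0 : col p .zero = a) (h1 : ∀ i, col p (.mid i) = 0)
    (h2 : col p .last = 0) : ∃ m ∈ M n, ∃ y : W n, p = m * dia n a * unip y := by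
  simp only [col] at h0 h1 h2
  have ha : (a : ℝ) ≠ 0 := a.ne_zero
  -- The first row of `m d(a) u(y)` begins with `a, a y`, which dictates `y`. Once `u(-y)` has
  -- cleared these entries, preservation of the form clears all other off-diagonal blocks.
  set y : W n := WithLp.toLp 2 fun j => mat p .zero (.mid j) / a with hy
  set q : G n := p * unip (-y) with hq
  have q00 : mat q .zero .zero = a := by rw [hq, mulVec_unip_col, h0]
  have qi0 : ∀ i, mat q (.mid i) .zero = 0 := fun i => by rw [hq, mulVec_unip_col, h1]
  have qn0 : mat q .last .zero = 0 := by rw [hq, mulVec_unip_col, h2]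
  have q0i : ∀ i, mat q .zero (.mid i) = 0 := fun i => by
    rw [hq, mat_mul_unip_mid, h0]
    simp only [hy, PiLp.neg_apply]
    field_simp
    ring
  have qni : ∀ i, mat q .last (.mid i) = 0 := fun i => by
    have := col_form q .zero (.mid i)
    have h' : gram n .zero (.mid i) = 0 := rfl
    simpa [q00, qi0, qn0, h', ha] using this
  have qnn : (a : ℝ) * mat q .last .last = 1 := by
    have := col_form q .zero .last
    have h' : gram n .zero .last = -1 := rfl
    simpa [q00, qi0, qn0, h', ha] using this
  have qin : ∀ i, mat q (.mid i) .last = 0 := fun i => by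
    have := row_form q .zero (.mid i)
    have h' : gram n .zero (.mid i) = 0 := rfl
    simpa [q00, q0i, qi0, h', ha] using this
  have q0n : mat q .zero .last = 0 := by
    have := row_form q .zero .zero
    have h' : gram n .zero .zero = 0 := rfl
    rw [q00, h'] at this
    simp only [q0i, mul_zero, Finset.sum_const_zero, add_zero] at this
    have h3 : (a : ℝ) * mat q .zero .last = 0 := by linarith
    exact (mul_eq_zero.mp h3).resolve_left ha
  refine ⟨q * dia n a⁻¹, ?_, y, ?_⟩
  · apply mem_M_of_block <;> intros <;>
      simp [mat_mul_dia, q00, qi0, qn0, q0i, qni, qin, q0n, ha]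
    rw [mul_comm]; exact qnn
  · have e1 : dia n a⁻¹ * dia n a = 1 := by
      apply mat_injective
      have := dMat_mul_inv n (inv_ne_zero ha)
      simpa using this
    have e2 : unip (-y) * unip y = 1 := by
      apply mat_injective
      simpa using uMat_mul_neg (-y)
    rw [mul_assoc q, e1, mul_one, hq, mul_assoc, e2, mul_one]

/-- The exponent `(1 + t) (n - 1) / 2` of homogeneity of the elements of `F_t`. -/
noncomputable def weight (n : ℕ) (t : ℝ) : ℝ := (1 + t) * (((n : ℝ) - 1) / 2)

/-! ### Equivariant functions as homogeneous functions on the cone -/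

theorem rhoP_rpow (a : ℝˣ) (t : ℝ) : rhoP n a ^ (-(1 + t)) = |(a : ℝ)| ^ (-weight n t) := by
  rw [rhoP, ← Real.rpow_mul (abs_nonneg _), weight]
  congr 1
  ring

/-- The transformation rule of the elements of `F_t`. -/
def IsEquivariant (t : ℝ) (f : G n → ℂ) : Prop :=
  ∀ (g : G n), ∀ m ∈ M n, ∀ (a : ℝˣ) (y : W n),
    f (g * m * dia n a * unip y) = f g * ((rhoP n a ^ (-(1 + t)) : ℝ) : ℂ)

/-- If the two columns are proportional, `h⁻¹ g` stabilizes the line of `e_0` and so lies in `M A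
N`, with `A`-part `d(a)`. -/
theorem IsEquivariant.eq_of_col {t : ℝ} {f : G n → ℂ} (hf : IsEquivariant t f) {g h : G n} {a : ℝ}
    (ha : a ≠ 0) (hgh : col g = a • col h) : f g = f h * ((|a| ^ (-weight n t) : ℝ) : ℂ) := by
  have hp : col (h⁻¹ * g) = a • col (1 : G n) := by
    rw [col_mul, hgh, Matrix.mulVec_smul, ← col_mul, inv_mul_cancel]
  obtain ⟨m, hm, y, hy⟩ := exists_eq_of_col (p := h⁻¹ * g) (Units.mk0 a ha)
    (by rw [hp]; simp [col]) (fun i => by rw [hp]; simp [col])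
    (by rw [hp]; simp [col])
  have hg : g = h * m * dia n (Units.mk0 a ha) * unip y := by
    rw [mul_assoc h, mul_assoc h, ← hy, mul_inv_cancel_left]
  have := hf h m hm (Units.mk0 a ha) y
  rw [← hg, rhoP_rpow, Units.val_mk0] at this
  exact this

/-- Commuting with `d(2)`, whose eigenvalues `2, 1, 1/2` are distinct, kills the rest of the first
column; orthogonality makes the surviving entry a sign. -/
theorem mem_M_col {m : G n} (hm : m ∈ M n) :
    ∃ e : ℝ, |e| = 1 ∧ col m = e • col (1 : G n) := by
  obtain ⟨hK, hc⟩ := hm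
  have hc := Subgroup.mem_centralizer_iff.mp hc _ ⟨Units.mk0 2 two_ne_zero, rfl⟩
  have hc' : ∀ i, mat (dia n (Units.mk0 2 two_ne_zero) * m) i .zero
      = mat (m * dia n (Units.mk0 2 two_ne_zero)) i .zero := fun i => by rw [hc]
  simp only [mat_mul_dia, mat_mul, mat_dia, dMat, Matrix.diagonal_mul, Units.val_mk0] at hc'
  have h1 : ∀ i, mat m (.mid i) .zero = 0 := fun i => by
    have := hc' (.mid i)
    simp only at this
    linarith
  have h2 : mat m .last .zero = 0 := by
    have := hc' .last
    simp only at this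
    linarith
  refine ⟨mat m .zero .zero, ?_, ?_⟩
  · have hK' : (mat m)ᵀ * mat m = 1 := (Matrix.mem_orthogonalGroup_iff' (Idx n) ℝ).mp hK
    have : ((mat m)ᵀ * mat m) .zero .zero = 1 := by rw [hK', Matrix.one_apply_eq]
    rw [Matrix.mul_apply, Idx.sum_eq] at this
    simp only [Matrix.transpose_apply, h1, h2, mul_zero, Finset.sum_const_zero, add_zero] at this
    rw [← sq_eq_sq₀ (abs_nonneg _) zero_le_one, sq_abs]
    linarith
  · ext i
    cases i <;> simp [col, h1, h2]

theorem col_mul_parabolic (g : G n) {m : G n} (hm : m ∈ M n) (a : ℝˣ) (y : W n) :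
    ∃ e : ℝ, |e| = |(a : ℝ)| ∧ e ≠ 0 ∧ col (g * m * dia n a * unip y) = e • col g := by
  obtain ⟨e, he, hme⟩ := mem_M_col hm
  refine ⟨a * e, by rw [abs_mul, he, mul_one], ?_, ?_⟩
  · have : e ≠ 0 := by rintro rfl; simp at he
    exact mul_ne_zero a.ne_zero this
  · have h1 : col (unip y) = col (1 : G n) := by
      have := mulVec_unip_col (1 : G n) y
      ext i
      simpa [col] using this i
    have h2 : col (dia n a) = (a : ℝ) • col (1 : G n) := by
      have := mat_mul_dia (1 : G n) a
      ext i
      have := this i .zero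
      rw [one_mul] at this
      simp only [col, this, Pi.smul_apply, smul_eq_mul, mul_comm]
    have h3 : ∀ h : G n, mat h *ᵥ col (1 : G n) = col h := fun h => by rw [← col_mul, mul_one]
    rw [mul_assoc, mul_assoc, col_mul, col_mul, col_mul, h1, h3, h2,
      Matrix.mulVec_smul, h3, hme, smul_smul, Matrix.mulVec_smul, h3]

/-- A function of the first column, homogeneous and even, is equivariant. -/
theorem isEquivariant_of_col {t : ℝ} {f : G n → ℂ}
    (h : ∀ (g k : G n) (a : ℝ), a ≠ 0 → col g = a • col k →
      f g = f k * ((|a| ^ (-weight n t) : ℝ) : ℂ)) : IsEquivariant t f := by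
  intro g m hm a y
  obtain ⟨e, he, he0, hc⟩ := col_mul_parabolic g hm a y
  rw [h _ _ e he0 hc, rhoP_rpow, he]

/-! ### Topology of `G` and `K` -/

theorem continuous_mat : Continuous (mat (n := n)) :=
  Units.continuous_val.comp continuous_subtype_val

theorem continuous_mat_apply (i j : Idx n) : Continuous fun g : G n => mat g i j :=
  (continuous_apply j).comp ((continuous_apply i).comp continuous_mat)

theorem continuous_col_apply (i : Idx n) : Continuous fun g : G n => col g i :=
  continuous_mat_apply i .zero

theorem continuous_of_mat {X : Type*} [TopologicalSpace X] {f : X → G n}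
    (h : ∀ i j, Continuous fun x => mat (f x) i j) : Continuous f := by
  have h' : Continuous fun x => mat (f x) := continuous_matrix h
  refine Continuous.subtype_mk (f := fun x => (f x : GL (Idx n) ℝ)) ?_ _
  refine Units.continuous_iff.mpr ⟨h', ?_⟩
  have : (fun x => (((f x : GL (Idx n) ℝ)⁻¹ : GL (Idx n) ℝ) : Matrix (Idx n) (Idx n) ℝ))
      = fun x => gram n * (mat (f x))ᵀ * gram n := by
    ext1 x
    exact mat_inv (f x)
  rw [this]
  fun_prop

theorem isInducing_mat : Topology.IsInducing (mat (n := n)) := by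
  refine ⟨le_antisymm continuous_mat.le_induced (continuous_id_iff_le.mp ?_)⟩
  refine @continuous_of_mat n (G n) (TopologicalSpace.induced mat inferInstance) id fun i j => ?_
  exact @Continuous.comp _ _ _ (TopologicalSpace.induced mat inferInstance) _ _ _ _
    (Continuous.matrix_elem continuous_id i j) continuous_induced_dom

theorem continuous_unip : Continuous (unip (n := n)) := by
  refine continuous_of_mat fun i j => ?_
  cases i <;> cases j <;> simp only [mat_unip, uMat, Matrix.of_apply] <;> fun_prop

/-! ### Sections attached to Schwartz functions -/

/-- The point `v' / v_n` of `W` attached to a vector `v` with `v_n ≠ 0`. -/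
noncomputable def affinePart (v : Idx n → ℝ) : W n :=
  WithLp.toLp 2 fun i => (v .last)⁻¹ * v (.mid i)

theorem affinePart_smul {a : ℝ} (ha : a ≠ 0) (v : Idx n → ℝ) :
    affinePart (a • v) = affinePart v := by
  ext i
  simp only [affinePart, Pi.smul_apply, smul_eq_mul, mul_inv]
  field_simp

theorem norm_sq_affinePart (g : G n) (h : col g .last ≠ 0) :
    ‖affinePart (col g)‖ ^ 2 = 2 * (col g .zero / col g .last) := by
  rw [EuclideanSpace.norm_sq_eq]
  simp only [affinePart, Real.norm_eq_abs, sq_abs, mul_pow]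
  rw [← Finset.mul_sum, sum_col_sq]
  field_simp

theorem col_eq_smul_of_last_ne_zero (g : G n) (h : col g .last ≠ 0) :
    col g = col g .last • col (unip (affinePart (col g)) * weyl n) := by
  rw [col_unip_mul_weyl]
  ext i
  cases i
  · simp only [Pi.smul_apply, smul_eq_mul, norm_sq_affinePart g h]
    field_simp
  · simp [affinePart, h]
  · simp

/-- If `(g e_0)_n = 0`, then `g e_0` is a multiple of `e_0`. -/
theorem col_eq_smul_of_last_eq_zero (g : G n) (h : col g .last = 0) :
    col g .zero ≠ 0 ∧ col g = col g .zero • col (1 : G n) := by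
  have hmid : ∀ i, col g (.mid i) = 0 := by
    have h1 := sum_col_sq g
    rw [h, mul_zero, Finset.sum_eq_zero_iff_of_nonneg fun i _ => sq_nonneg _] at h1
    exact fun i => pow_eq_zero_iff two_ne_zero |>.mp (h1 i (Finset.mem_univ i))
  have hc : col g = col g .zero • col (1 : G n) := by
    ext i
    cases i
    · simp [col]
    · rw [hmid]; simp [col]
    · rw [h]; simp [col]
  refine ⟨fun h0 => ?_, hc⟩
  rw [h0, zero_smul] at hc
  have : col (g⁻¹ * g) = 0 := by rw [col_mul, hc, Matrix.mulVec_zero]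
  rw [inv_mul_cancel] at this
  have := congrFun this .zero
  simp [col] at this

/-- The size `|v_0| + |v_n|` of a vector of the light cone. -/
noncomputable def size (g : G n) : ℝ := |col g .zero| + |col g .last|

theorem size_pos (g : G n) : 0 < size g := by
  by_cases h : col g .last = 0
  · have := abs_pos.mpr (col_eq_smul_of_last_eq_zero g h).1
    have := abs_nonneg (col g .last)
    unfold size
    linarith
  · have := abs_pos.mpr h
    have := abs_nonneg (col g .zero)
    unfold size
    linarith

theorem size_eq (g : G n) (h : col g .last ≠ 0) :
    size g = |col g .last| * (1 + ‖affinePart (col g)‖ ^ 2 / 2) := by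
  have h1 := norm_sq_affinePart g h
  have h2 : 0 ≤ col g .zero / col g .last := by
    have := sq_nonneg ‖affinePart (col g)‖
    linarith
  rw [size, h1, mul_div_cancel_left₀ _ two_ne_zero, ← abs_of_nonneg h2, abs_div]
  field_simp [abs_ne_zero.mpr h]
  ring

/-- On the cone a middle coordinate satisfies `v_i² ≤ 2 v_0 v_n`, so `v_0` and `v_n` alone control
the whole vector. -/
theorem abs_col_le (g : G n) (i : Idx n) : |col g i| ≤ size g := by
  cases i with
  | zero => exact le_add_of_nonneg_right (abs_nonneg _)
  | last => exact le_add_of_nonneg_left (abs_nonneg _)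
  | mid i =>
    apply abs_le_of_sq_le_sq _ (size_pos g).le
    have h1 : col g (.mid i) ^ 2 ≤ 2 * col g .zero * col g .last := by
      rw [← sum_col_sq]
      exact Finset.single_le_sum (f := fun i => col g (.mid i) ^ 2)
        (fun i _ => sq_nonneg _) (Finset.mem_univ i)
    have h2 : col g .zero * col g .last ≤ |col g .zero| * |col g .last| := by
      rw [← abs_mul]; exact le_abs_self _
    unfold size
    nlinarith [sq_nonneg |col g .zero|, sq_nonneg |col g .last|]

theorem size_unip_mul_weyl (x : W n) : size (unip x * weyl n) = 1 + ‖x‖ ^ 2 / 2 := by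
  rw [size, col_unip_mul_weyl]
  simp only [abs_one]
  rw [abs_of_nonneg (by positivity)]
  ring

theorem continuous_size : Continuous (size (n := n)) :=
  (continuous_col_apply _).abs.add (continuous_col_apply _).abs

/-- The extension of a function on `W` to `G`, homogeneous of degree `-s` on the light cone. -/
noncomputable def coneExtension (s : ℝ) (φ : W n → ℂ) (g : G n) : ℂ :=
  ((|col g .last| ^ (-s) : ℝ) : ℂ) * φ (affinePart (col g))

theorem isEquivariant_coneExtension (t : ℝ) (φ : W n → ℂ) :
    IsEquivariant t (coneExtension (weight n t) φ) := by
  refine isEquivariant_of_col fun g k a ha h => ?_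
  rw [coneExtension, coneExtension, h, affinePart_smul ha, Pi.smul_apply, smul_eq_mul, abs_mul,
    Real.mul_rpow (abs_nonneg _) (abs_nonneg _)]
  push_cast
  ring

theorem coneExtension_unip_mul_weyl (s : ℝ) (φ : W n → ℂ) (x : W n) :
    coneExtension s φ (unip x * weyl n) = φ x := by
  rw [coneExtension, col_unip_mul_weyl]
  simp [affinePart]

theorem weight_pos (hn : 2 ≤ n) {t : ℝ} (ht : 0 < t) : 0 < weight n t := by
  have : (2 : ℝ) ≤ n := by exact_mod_cast hn
  unfold weight
  have : 0 < ((n : ℝ) - 1) / 2 := by linarith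
  positivity

theorem exists_bound_schwartz (φ : 𝓢(W n, ℂ)) (k : ℕ) :
    ∃ C : ℝ, 0 ≤ C ∧ ∀ x, ‖φ x‖ ≤ C * ((1 + ‖x‖ ^ 2 / 2) ^ k)⁻¹ := by
  obtain ⟨C, h⟩ : ∃ C : ℝ, ∀ x, (1 + ‖x‖) ^ (2 * k) * ‖φ x‖ ≤ C := by
    refine ⟨2 ^ (2 * k) * (Finset.Iic (2 * k, 0)).sup
      (fun m => SchwartzMap.seminorm ℝ m.1 m.2) φ, fun x => ?_⟩
    simpa using SchwartzMap.one_add_le_sup_seminorm_apply (𝕜 := ℝ) (m := (2 * k, 0))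
      le_rfl le_rfl φ x
  have hC : 0 ≤ C := le_trans (by positivity) (h 0)
  refine ⟨C, hC, fun x => ?_⟩
  rw [← div_eq_mul_inv, le_div_iff₀ (by positivity)]
  refine le_trans ?_ (h x)
  rw [mul_comm]
  gcongr
  rw [pow_mul]
  gcongr
  nlinarith [norm_nonneg x]

/-- Only points with `v_n = 0` matter. There the decay of `φ` to an order `k > s`, combined with
`size_eq`, bounds the extension by a multiple of `|v_n|^(k - s) / size^k`, which tends to zero. -/
theorem continuous_coneExtension {s : ℝ} (hs : 0 < s) (φ : 𝓢(W n, ℂ)) :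
    Continuous (coneExtension s φ) := by
  rw [continuous_iff_continuousAt]
  intro g₀
  by_cases h : col g₀ .last = 0
  · obtain ⟨k, hk⟩ := exists_nat_gt s
    obtain ⟨C, hC, hφ⟩ := exists_bound_schwartz φ k
    -- The convention that a nonzero real power of `0` is `0` gives the extension the correct value
    -- here.
    have hval : coneExtension s φ g₀ = 0 := by
      rw [coneExtension, h, abs_zero, Real.zero_rpow (by linarith)]
      simp
    have hbound : ∀ g : G n, ‖coneExtension s φ g‖
        ≤ C * |col g .last| ^ ((k : ℝ) - s) * (size g ^ k)⁻¹ := by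
      intro g
      by_cases hg : col g .last = 0
      · rw [coneExtension, hg, abs_zero, Real.zero_rpow (by linarith)]
        have := size_pos g
        have : 0 ≤ (0 : ℝ) ^ ((k : ℝ) - s) := Real.rpow_nonneg le_rfl _
        simp only [Complex.ofReal_zero, zero_mul, norm_zero]
        positivity
      · have hp : 0 < |col g .last| := abs_pos.mpr hg
        rw [coneExtension, norm_mul, Complex.norm_real, Real.norm_of_nonneg (by positivity),
          size_eq g hg, sub_eq_add_neg, Real.rpow_add hp, Real.rpow_natCast, mul_pow]
        calc |col g .last| ^ (-s) * ‖φ (affinePart (col g))‖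
            ≤ |col g .last| ^ (-s) * (C * ((1 + ‖affinePart (col g)‖ ^ 2 / 2) ^ k)⁻¹) := by
              gcongr
              exact hφ _
          _ = _ := by field_simp
    have hlim : Filter.Tendsto (fun g : G n => C * |col g .last| ^ ((k : ℝ) - s) * (size g ^ k)⁻¹)
        (nhds g₀) (nhds 0) := by
      have h1 : ContinuousAt
          (fun g : G n => C * |col g .last| ^ ((k : ℝ) - s) * (size g ^ k)⁻¹) g₀ := by
        refine ContinuousAt.mul (ContinuousAt.mul continuousAt_const ?_)
          (ContinuousAt.inv₀ (continuous_size.pow k).continuousAt (pow_pos (size_pos _) _).ne')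
        exact (continuous_col_apply _).abs.continuousAt.rpow_const (Or.inr (by linarith))
      have h2 := h1.tendsto
      rwa [h, abs_zero, Real.zero_rpow (by linarith), mul_zero, zero_mul] at h2
    rw [ContinuousAt, hval]
    exact squeeze_zero_norm hbound hlim
  · refine ContinuousAt.mul (Complex.continuous_ofReal.continuousAt.comp ?_)
      (φ.continuous.continuousAt.comp ?_)
    · exact (continuous_col_apply _).abs.continuousAt.rpow_const (Or.inl (abs_ne_zero.mpr h))
    · refine (PiLp.continuous_toLp 2 _).continuousAt.comp (continuousAt_pi.mpr fun i => ?_)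
      exact ((continuous_col_apply _).continuousAt.inv₀ h).mul
        (continuous_col_apply _).continuousAt

theorem isSectionOf_coneExtension (hn : 2 ≤ n) {u : ℝ} (hu : 0 < u) (φ : 𝓢(W n, ℂ)) :
    IsSectionOf u φ (coneExtension (weight n u) φ) :=
  ⟨⟨continuous_coneExtension (weight_pos hn hu) φ, isEquivariant_coneExtension u φ⟩,
    coneExtension_unip_mul_weyl _ _⟩

/-- The big cell is dense: each `g` outside of it is the limit at `0` of a curve that lies
in it. -/
theorem exists_curve (hn : 2 ≤ n) (g : G n) (h : col g .last = 0) :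
    ∃ γ : ℝ → G n, Continuous γ ∧ γ 0 = g ∧ ∀ t ≠ 0, col (γ t) .last ≠ 0 := by
  set y : W n := EuclideanSpace.single (⟨0, by omega⟩ : Fin (n - 1)) 1 with hy
  have hyn : ‖y‖ = 1 := by simp [hy]
  have ww : weyl n * weyl n = 1 := mat_injective (wMat_mul_self n)
  -- The first column of `w u(t y) w` is `(1, t y, t²/2)`. The last row of `g` vanishes except for
  -- its last entry, so the last coordinate along the curve is a nonzero multiple of `t²`.
  refine ⟨fun t => g * (weyl n * (unip (t • y) * weyl n)), ?_, ?_, fun t ht => ?_⟩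
  · exact continuous_const.mul (continuous_const.mul ((continuous_unip.comp
      (continuous_id.smul continuous_const)).mul continuous_const))
  · have h0 : unip (0 : W n) = 1 := by
      apply mat_injective
      ext i j
      cases i <;> cases j <;> simp [uMat, Matrix.one_apply]
    simp only [zero_smul, h0, one_mul, ww, mul_one]
  · obtain ⟨h0, hc⟩ := col_eq_smul_of_last_eq_zero g h
    have hm : ∀ i, mat g (.mid i) .zero = 0 := fun i => by
      have := congrFun hc (.mid i)
      simpa [col] using this
    simp only [col] at h h0
    have h1 : ∀ i, mat g .last (.mid i) = 0 := fun i => by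
      have := col_form g .zero (.mid i)
      have h' : gram n .zero (.mid i) = 0 := rfl
      simpa [h', h, hm, h0] using this
    have h2 : mat g .last .last ≠ 0 := fun hz => by
      have := col_form g .zero .last
      have h' : gram n .zero .last = -1 := rfl
      simp [h', h, hm, hz] at this
    rw [col_mul, col_mul, col_unip_mul_weyl, mulVec_eq, mulVec_eq]
    simp only [mat_weyl, h1, h, mulVec_eq, zero_mul, zero_add, Finset.sum_const_zero]
    simp [wMat, norm_smul, hyn, ht, h2]

theorem IsSectionOf.unique (hn : 2 ≤ n) {u : ℝ} {φ : 𝓢(W n, ℂ)} {f f' : G n → ℂ}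
    (hf : IsSectionOf u φ f) (hf' : IsSectionOf u φ f') : f = f' := by
  have key : ∀ g : G n, col g .last ≠ 0 → f g = f' g := fun g hg => by
    have hc := col_eq_smul_of_last_ne_zero g hg
    rw [IsEquivariant.eq_of_col hf.1.2 hg hc, IsEquivariant.eq_of_col hf'.1.2 hg hc, hf.2, hf'.2]
  ext g
  by_cases hg : col g .last = 0
  · obtain ⟨γ, hγ, h0, h1⟩ := exists_curve hn g hg
    have h2 : Set.EqOn (f ∘ γ) (f' ∘ γ) {0}ᶜ := fun t ht => key _ (h1 t ht)
    have h3 : f ∘ γ = f' ∘ γ := Continuous.ext_on (dense_compl_singleton 0)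
      (hf.1.1.comp hγ) (hf'.1.1.comp hγ) h2
    have := congrFun h3 0
    simpa [h0] using this
  · exact key g hg

/-! ### The Iwasawa decomposition -/

/-- The vector `(1, -x, -1)`, orthogonal to the hyperplane of the reflection `reflK x`. -/
def reflVec (x : W n) : Idx n → ℝ
  | .zero => 1
  | .mid i => -x i
  | .last => -1

/-- The orthogonal reflection that maps `e_0` to a multiple of `u(x) e_n`. -/
noncomputable def reflMat (x : W n) : Matrix (Idx n) (Idx n) ℝ :=
  1 - (1 + ‖x‖ ^ 2 / 2)⁻¹ • Matrix.vecMulVec (reflVec x) (reflVec x)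

theorem reflVec_dotProduct (x : W n) : reflVec x ⬝ᵥ reflVec x = 2 * (1 + ‖x‖ ^ 2 / 2) := by
  simp only [dotProduct, Idx.sum_eq, reflVec, EuclideanSpace.norm_sq_eq, Real.norm_eq_abs, sq_abs,
    ← pow_two, neg_sq]
  ring

theorem reflMat_mul_self (x : W n) : reflMat x * reflMat x = 1 := by
  have h : (1 + ‖x‖ ^ 2 / 2) ≠ 0 := by positivity
  simp only [reflMat, Matrix.sub_mul, Matrix.mul_sub, Matrix.mul_one, Matrix.one_mul,
    Matrix.smul_mul, Matrix.mul_smul, Matrix.vecMulVec_mul_vecMulVec, reflVec_dotProduct]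
  ext i j
  simp only [Matrix.sub_apply, Matrix.smul_apply, smul_eq_mul, Matrix.vecMulVec_smul]
  field_simp
  ring

theorem gram_mulVec_reflVec (x : W n) : gram n *ᵥ reflVec x = reflVec x := by
  ext i
  rw [mulVec_eq]
  cases i <;> simp [gram, reflVec]

/-- The vector `reflVec x` is fixed by the Gram matrix, so the orthogonal reflection along it
commutes with that matrix; this places the reflection in `K n`. -/
theorem reflMat_comm (x : W n) : reflMat x * gram n = gram n * reflMat x := by
  have h : reflVec x ᵥ* gram n = reflVec x := by
    rw [← Matrix.mulVec_transpose, gram_transpose, gram_mulVec_reflVec]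
  simp only [reflMat, Matrix.sub_mul, Matrix.mul_sub, Matrix.one_mul, Matrix.mul_one,
    Matrix.smul_mul, Matrix.mul_smul, Matrix.vecMulVec_mul, Matrix.mul_vecMulVec,
    gram_mulVec_reflVec, h]

theorem reflMat_transpose (x : W n) : (reflMat x)ᵀ = reflMat x := by
  rw [reflMat, Matrix.transpose_sub, Matrix.transpose_one, Matrix.transpose_smul,
    Matrix.transpose_vecMulVec]

/-- The reflection `reflMat x` as an element of `K`. -/
noncomputable def reflK (x : W n) : K n :=
  ⟨⟨⟨reflMat x, reflMat x, reflMat_mul_self x, reflMat_mul_self x⟩, by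
    change (reflMat x)ᵀ * gram n * reflMat x = gram n
    rw [reflMat_transpose, reflMat_comm, Matrix.mul_assoc, reflMat_mul_self, Matrix.mul_one]⟩,
    mem_K_of_commute (reflMat_comm x)⟩

theorem mat_reflK (x : W n) : mat (reflK (n := n) x : G n) = reflMat x := rfl

theorem continuous_reflK : Continuous (reflK (n := n)) := by
  refine Continuous.subtype_mk (f := fun x => (reflK (n := n) x : G n)) (continuous_of_mat fun i j => ?_) _
  have h : ∀ i, Continuous fun x : W n => reflVec x i := fun i => by
    cases i <;> simp only [reflVec] <;> fun_prop
  simp only [mat_reflK, reflMat, Matrix.sub_apply, Matrix.smul_apply, Matrix.vecMulVec_apply,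
    smul_eq_mul]
  refine continuous_const.sub (Continuous.mul (Continuous.inv₀ (by fun_prop) fun x => ?_)
    ((h i).mul (h j)))
  positivity

theorem col_unip_mul_weyl_eq_smul_reflK (x : W n) :
    col (unip x * weyl n) = (1 + ‖x‖ ^ 2 / 2) • col (reflK (n := n) x : G n) := by
  have h : (1 + ‖x‖ ^ 2 / 2) ≠ 0 := by positivity
  rw [col_unip_mul_weyl]
  ext i
  simp only [col, mat_reflK, reflMat, Pi.smul_apply, Matrix.sub_apply, Matrix.smul_apply,
    Matrix.vecMulVec_apply, smul_eq_mul, Matrix.one_apply]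
  cases i <;> simp [reflVec] <;> field_simp
  ring

theorem IsEquivariant.mul_unip_mul_weyl {t : ℝ} {f : G n → ℂ} (hf : IsEquivariant t f) (g : G n)
    (x : W n) : f (g * unip x * weyl n)
      = f (g * (reflK (n := n) x : G n)) * (((1 + ‖x‖ ^ 2 / 2) ^ (-weight n t) : ℝ) : ℂ) := by
  have h : 0 < 1 + ‖x‖ ^ 2 / 2 := by positivity
  rw [hf.eq_of_col (h := g * (reflK (n := n) x : G n)) h.ne', abs_of_pos h]
  rw [mul_assoc, col_mul, col_unip_mul_weyl_eq_smul_reflK, Matrix.mulVec_smul, ← col_mul]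

theorem abs_mat_le_of_mem_K {k : G n} (hk : k ∈ K n) (i j : Idx n) : |mat k i j| ≤ 1 := by
  have h1 : (mat k)ᵀ * mat k = 1 := (Matrix.mem_orthogonalGroup_iff' (Idx n) ℝ).mp hk
  have h2 : ((mat k)ᵀ * mat k) j j = 1 := by rw [h1, Matrix.one_apply_eq]
  rw [Matrix.mul_apply] at h2
  have h3 := Finset.single_le_sum (f := fun i => (mat k)ᵀ j i * mat k i j)
    (fun i _ => mul_self_nonneg _) (Finset.mem_univ i)
  rw [h2] at h3
  apply abs_le_of_sq_le_sq _ zero_le_one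
  simpa [pow_two] using h3

theorem isCompact_K : IsCompact (K n : Set (G n)) := by
  rw [isInducing_mat.isCompact_iff]
  have hT : IsCompact {A : Matrix (Idx n) (Idx n) ℝ | ∀ i j, A i j ∈ Set.Icc (-1 : ℝ) 1} := by
    have : IsCompact (Set.univ.pi fun _ : Idx n => Set.univ.pi fun _ : Idx n =>
      Set.Icc (-1 : ℝ) 1) := isCompact_univ_pi fun _ => isCompact_univ_pi fun _ => isCompact_Icc
    convert! this using 1
    ext A
    exact ⟨fun h i _ j _ => h i j, fun h i j => h i trivial j trivial⟩
  have himg : mat '' (K n : Set (G n)) = {A | Aᵀ * gram n * A = gram n} ∩ {A | Aᵀ * A = 1} := by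
    ext A
    constructor
    · rintro ⟨k, hk, rfl⟩
      exact ⟨mat_transpose_mul k, (Matrix.mem_orthogonalGroup_iff' (Idx n) ℝ).mp hk⟩
    · rintro ⟨h1, h2⟩
      exact ⟨⟨⟨A, Aᵀ, mul_eq_one_comm.mp h2, h2⟩, h1⟩,
        (Matrix.mem_orthogonalGroup_iff' (Idx n) ℝ).mpr h2, rfl⟩
  refine hT.of_isClosed_subset ?_ ?_
  · rw [himg]
    exact (isClosed_eq (by fun_prop) continuous_const).inter
      (isClosed_eq (by fun_prop) continuous_const)
  · rintro _ ⟨k, hk, rfl⟩ i j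
    exact abs_le.mp (abs_mat_le_of_mem_K hk i j)

instance : CompactSpace (K n) := isCompact_iff_compactSpace.mp isCompact_K

instance : SecondCountableTopology (G n) :=
  haveI : SecondCountableTopology (Matrix (Idx n) (Idx n) ℝ) :=
    inferInstanceAs (SecondCountableTopology (Idx n → Idx n → ℝ))
  isInducing_mat.secondCountableTopology

/-! ### The intertwining integral -/

/-- By the Iwasawa decomposition each cone vector is `a • col k` with `k ∈ K n` and size `|a|`, so
homogeneity reduces the bound to compactness of `K n`. -/
theorem exists_bound_of_mem_F {t : ℝ} {f : G n → ℂ} (hf : f ∈ F n t) :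
    ∃ C : ℝ, 0 ≤ C ∧ ∀ g, ‖f g‖ ≤ C * size g ^ (-weight n t) := by
  obtain ⟨C, hC⟩ := isCompact_K.exists_bound_of_continuousOn hf.1.continuousOn
  refine ⟨C, (norm_nonneg _).trans (hC 1 (one_mem _)), fun g => ?_⟩
  obtain ⟨k, hk, a, ha, hga, hsize⟩ : ∃ k ∈ K n, ∃ a : ℝ, a ≠ 0 ∧ col g = a • col k ∧
      size g = |a| := by
    by_cases h : col g .last = 0
    · obtain ⟨h1, h2⟩ := col_eq_smul_of_last_eq_zero g h
      exact ⟨1, one_mem _, _, h1, h2, by simp [size, h]⟩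
    · have h1 := col_eq_smul_of_last_ne_zero g h
      rw [col_unip_mul_weyl_eq_smul_reflK, smul_smul] at h1
      have h2 : 0 < 1 + ‖affinePart (col g)‖ ^ 2 / 2 := by positivity
      refine ⟨_, (reflK _).2, _, mul_ne_zero h h2.ne', h1, ?_⟩
      rw [size_eq g h, abs_mul, abs_of_pos h2]
  have hf' : IsEquivariant t f := hf.2
  rw [hf'.eq_of_col ha hga, norm_mul, Complex.norm_real, Real.norm_of_nonneg (by positivity),
    hsize]
  gcongr
  exact hC k hk

/-- A bound for the contraction of the light cone by `g`. -/
noncomputable def expansion (g : G n) : ℝ :=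
  ∑ i, (|mat g⁻¹ .zero i| + |mat g⁻¹ .last i|)

theorem continuous_expansion : Continuous (expansion (n := n)) := by
  unfold expansion
  exact continuous_finsetSum _ fun i _ =>
    ((continuous_mat_apply _ _).comp continuous_inv).abs.add
      ((continuous_mat_apply _ _).comp continuous_inv).abs

/-- Write `h = g⁻¹ (g h)` and bound each coordinate of `col (g * h)` by its size. -/
theorem size_le_expansion_mul (g h : G n) : size h ≤ expansion g * size (g * h) := by
  have key : ∀ i, |col h i| ≤ ∑ j, |mat g⁻¹ i j| * size (g * h) := fun i => by
    have : col h = mat g⁻¹ *ᵥ col (g * h) := by rw [← col_mul, inv_mul_cancel_left]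
    rw [this, Matrix.mulVec, dotProduct]
    refine (Finset.abs_sum_le_sum_abs _ _).trans (Finset.sum_le_sum fun j _ => ?_)
    rw [abs_mul]
    gcongr
    exact abs_col_le _ _
  calc size h ≤ ∑ j, |mat g⁻¹ .zero j| * size (g * h) + ∑ j, |mat g⁻¹ .last j| * size (g * h) :=
        add_le_add (key _) (key _)
    _ = _ := by rw [expansion, Finset.sum_mul, ← Finset.sum_add_distrib]; simp only [add_mul]

theorem expansion_pos (g : G n) : 0 < expansion g := by
  have := size_le_expansion_mul g 1
  exact pos_of_mul_pos_left ((size_pos 1).trans_le this) (size_pos _).le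

theorem cast_pred (hn : 2 ≤ n) : ((n - 1 : ℕ) : ℝ) = (n : ℝ) - 1 := by
  rw [Nat.cast_sub (by omega), Nat.cast_one]

/-- The decay exponent is `2 * weight n t = (1 + t)(n - 1)`, which exceeds the dimension `n - 1`
exactly because `t > 0`. -/
theorem integrable_rpow_neg_weight (hn : 2 ≤ n) {t : ℝ} (ht : 0 < t) :
    Integrable fun x : W n => (1 + ‖x‖ ^ 2 / 2) ^ (-weight n t) := by
  have hw := weight_pos hn ht
  have h2 : (2 : ℝ) ≤ n := by exact_mod_cast hn
  have h := integrable_rpow_neg_one_add_norm_sq (E := W n) (μ := volume) (r := 2 * weight n t) (by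
    rw [finrank_euclideanSpace_fin, cast_pred hn, weight]
    nlinarith)
  refine (h.const_mul ((2 : ℝ) ^ weight n t)).mono' ?_ (Filter.Eventually.of_forall fun x => ?_)
  · apply Measurable.aestronglyMeasurable (by fun_prop)
  · rw [Real.norm_of_nonneg (by positivity)]
    have e1 : -(2 * weight n t) / 2 = -weight n t := by ring
    have e2 : (2 : ℝ) ^ weight n t = (2⁻¹ : ℝ) ^ (-weight n t) := by
      rw [Real.rpow_neg (by norm_num), Real.inv_rpow (by norm_num), inv_inv]
    rw [e1, e2, ← Real.mul_rpow (by norm_num) (by positivity)]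
    refine Real.rpow_le_rpow_of_nonpos (by positivity) ?_ (by linarith)
    linarith

theorem continuous_integrand {f : G n → ℂ} (hf : Continuous f) (g : G n) :
    Continuous fun x : W n => f (g * unip x * weyl n) :=
  hf.comp ((continuous_const.mul continuous_unip).mul continuous_const)

theorem norm_integrand_le {t C : ℝ} (hw : 0 ≤ weight n t) (hC : 0 ≤ C) {f : G n → ℂ}
    (hf : ∀ g, ‖f g‖ ≤ C * size g ^ (-weight n t)) {g : G n} {B : ℝ} (hB : expansion g ≤ B)
    (x : W n) : ‖f (g * unip x * weyl n)‖
      ≤ C * B ^ weight n t * (1 + ‖x‖ ^ 2 / 2) ^ (-weight n t) := by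
  have hB0 : 0 < B := (expansion_pos g).trans_le hB
  refine (hf _).trans ?_
  rw [mul_assoc C]
  gcongr
  have h1 := size_le_expansion_mul g (unip x * weyl n)
  rw [size_unip_mul_weyl, ← mul_assoc] at h1
  have h3 := size_pos (g * unip x * weyl n)
  have h2 : 1 + ‖x‖ ^ 2 / 2 ≤ B * size (g * unip x * weyl n) := h1.trans (by gcongr)
  have h4 : B ^ weight n t = (B⁻¹) ^ (-weight n t) := by
    rw [Real.rpow_neg (by positivity), Real.inv_rpow hB0.le, inv_inv]
  rw [h4, ← Real.mul_rpow (by positivity) (by positivity)]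
  refine Real.rpow_le_rpow_of_nonpos (by positivity) ?_ (by linarith)
  rwa [inv_mul_le_iff₀ hB0]

theorem integrable_integrand (hn : 2 ≤ n) {t : ℝ} (ht : 0 < t) {f : G n → ℂ} (hf : f ∈ F n t)
    (g : G n) : Integrable fun x : W n => f (g * unip x * weyl n) := by
  obtain ⟨C, hC, hb⟩ := exists_bound_of_mem_F hf
  exact ((integrable_rpow_neg_weight hn ht).const_mul _).mono'
    (continuous_integrand hf.1 g).aestronglyMeasurable
    (Filter.Eventually.of_forall (norm_integrand_le (weight_pos hn ht).le hC hb le_rfl))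

theorem continuous_intertwining (hn : 2 ≤ n) {t : ℝ} (ht : 0 < t) {f : G n → ℂ}
    (hf : f ∈ F n t) : Continuous (intertwining f) := by
  obtain ⟨C, hC, hb⟩ := exists_bound_of_mem_F hf
  rw [continuous_iff_continuousAt]
  intro g₀
  refine continuousAt_of_dominated
    (bound := fun x => C * (expansion g₀ + 1) ^ weight n t * (1 + ‖x‖ ^ 2 / 2) ^ (-weight n t))
    (Filter.Eventually.of_forall fun g => (continuous_integrand hf.1 g).aestronglyMeasurable) ?_
    ((integrable_rpow_neg_weight hn ht).const_mul _)
    (Filter.Eventually.of_forall fun x => (hf.1.comp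
      ((continuous_id.mul continuous_const).mul continuous_const)).continuousAt)
  -- Continuity of `expansion` makes one dominating function serve a whole neighbourhood of `g₀`.
  have : ∀ᶠ g in nhds g₀, expansion g < expansion g₀ + 1 :=
    continuous_expansion.continuousAt.eventually_lt continuousAt_const (by simp)
  filter_upwards [this] with g hg
  exact Filter.Eventually.of_forall (norm_integrand_le (weight_pos hn ht).le hC hb hg.le)

theorem unip_add (x y : W n) : unip (x + y) = unip x * unip y := by
  apply mat_injective
  ext i j
  simp only [mat_mul, mat_unip, Matrix.mul_apply, Idx.sum_eq]
  cases i <;> cases j <;> simp [uMat]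
  · ring
  · rw [norm_add_sq_real, PiLp.inner_apply]
    simp only [RCLike.inner_apply, conj_trivial, mul_comm]
    ring
  · ring

theorem intertwining_mul_unip (f : G n → ℂ) (g : G n) (y : W n) :
    intertwining f (g * unip y) = intertwining f g := by
  simp only [intertwining]
  rw [← integral_add_left_eq_self (fun x : W n => f (g * unip x * weyl n)) y]
  simp only [unip_add, mul_assoc]

theorem col_dia_mul (a : ℝˣ) (x : W n) :
    col (dia n a * (unip x * weyl n)) = (a : ℝ)⁻¹ • col (unip ((a : ℝ) • x) * weyl n) := by
  have ha := a.ne_zero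
  rw [col_mul, col_unip_mul_weyl, col_unip_mul_weyl]
  ext i
  simp only [mat_dia, dMat, Matrix.mulVec_diagonal, Pi.smul_apply, smul_eq_mul]
  cases i <;> simp [norm_smul, mul_pow]
  field_simp

theorem weight_add_weight_neg (t : ℝ) : weight n t + weight n (-t) = (n : ℝ) - 1 := by
  unfold weight
  ring

/-- Moving `d(a)` past `u(x) w` dilates `x` by `a` and costs `|a|^(weight n t)`; the Jacobian is
`|a|^(-(n - 1))`. The exponents add up to `-weight n (-t)`. -/
theorem intertwining_mul_dia (hn : 2 ≤ n) {t : ℝ} {f : G n → ℂ} (hf : IsEquivariant t f)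
    (g : G n) (a : ℝˣ) : intertwining f (g * dia n a)
      = intertwining f g * ((|(a : ℝ)| ^ (-weight n (-t)) : ℝ) : ℂ) := by
  have ha := a.ne_zero
  have h0 : 0 < |(a : ℝ)| := abs_pos.mpr ha
  have h : ∀ x : W n, f (g * dia n a * unip x * weyl n)
      = f (g * unip ((a : ℝ) • x) * weyl n) * ((|(a : ℝ)| ^ weight n t : ℝ) : ℂ) := fun x => by
    rw [hf.eq_of_col (h := g * unip ((a : ℝ) • x) * weyl n) (inv_ne_zero ha), abs_inv,
      Real.inv_rpow h0.le, Real.rpow_neg h0.le, inv_inv]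
    rw [mul_assoc, mul_assoc, col_mul, col_dia_mul, Matrix.mulVec_smul, ← col_mul, mul_assoc]
  simp only [intertwining, h]
  rw [integral_mul_const, Measure.integral_comp_smul volume
    (fun x : W n => f (g * unip x * weyl n)), finrank_euclideanSpace_fin, Complex.real_smul,
    mul_comm (Complex.ofReal _) (integral _ _), mul_assoc, ← Complex.ofReal_mul]
  congr 2
  rw [abs_inv, abs_pow, ← Real.rpow_natCast, cast_pred hn, ← Real.rpow_neg h0.le,
    ← Real.rpow_add h0]
  congr 1
  have := weight_add_weight_neg (n := n) t
  linarith

/-- An element of `M` is block diagonal `(e, m', e)` with `e = ±1`, and `e m'` is the isometry; its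
norm preservation is read off the cone equation. -/
theorem exists_linearIsometry_of_mem_M {m : G n} (hm : m ∈ M n) :
    ∃ (T : W n →ₗᵢ[ℝ] W n) (e : ℝ), |e| = 1 ∧
      ∀ x, col (m * (unip x * weyl n)) = e • col (unip (T x) * weyl n) := by
  obtain ⟨e, he, hcol⟩ := mem_M_col hm
  have he0 : e ≠ 0 := by rintro rfl; simp at he
  have hee : e * e = 1 := by rw [← abs_mul_abs_self, he, one_mul]
  have hc := Subgroup.mem_centralizer_iff.mp hm.2 _ ⟨Units.mk0 2 two_ne_zero, rfl⟩
  have hc' : ∀ i j, mat (dia n (Units.mk0 2 two_ne_zero) * m) i j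
      = mat (m * dia n (Units.mk0 2 two_ne_zero)) i j := fun i j => by rw [hc]
  simp only [mat_mul_dia, mat_mul, mat_dia, dMat, Matrix.diagonal_mul, Units.val_mk0] at hc'
  have h00 : mat m .zero .zero = e := by simpa [col] using congrFun hcol .zero
  have h10 : ∀ i, mat m (.mid i) .zero = 0 := fun i => by
    simpa [col] using congrFun hcol (.mid i)
  have hn0 : mat m .last .zero = 0 := by simpa [col] using congrFun hcol .last
  have h0i : ∀ i, mat m .zero (.mid i) = 0 := fun i => by
    have := hc' .zero (.mid i)
    simp only at this
    linarith
  have hni : ∀ i, mat m .last (.mid i) = 0 := fun i => by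
    have := hc' .last (.mid i)
    simp only at this
    linarith
  have h0n : mat m .zero .last = 0 := by
    have := hc' .zero .last
    simp only at this
    linarith
  have hin : ∀ i, mat m (.mid i) .last = 0 := fun i => by
    have := hc' (.mid i) .last
    simp only at this
    linarith
  have hnn : mat m .last .last = e := by
    have := col_form m .zero .last
    have h' : gram n .zero .last = -1 := rfl
    simp only [h00, h10, hn0, h', zero_mul, Finset.sum_const_zero] at this
    have h3 : e * mat m .last .last = e * e := by linarith
    exact mul_left_cancel₀ he0 h3
  have hval : ∀ x : W n, col (m * (unip x * weyl n)) = fun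
      | .zero => e * (‖x‖ ^ 2 / 2)
      | .mid i => ∑ j, mat m (.mid i) (.mid j) * x j
      | .last => e := fun x => by
    rw [col_mul, col_unip_mul_weyl]
    ext i
    rw [mulVec_eq]
    cases i <;> simp [h00, h10, hn0, h0i, hni, h0n, hin, hnn]
  let T : W n →ₗ[ℝ] W n :=
    { toFun := fun x => WithLp.toLp 2 fun i => e * ∑ j, mat m (.mid i) (.mid j) * x j
      map_add' := fun x y => by
        ext i
        simp [mul_add, Finset.sum_add_distrib]
      map_smul' := fun c x => by
        ext i
        simp only [PiLp.smul_apply, smul_eq_mul, RingHom.id_apply, Finset.mul_sum]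
        exact Finset.sum_congr rfl fun j _ => by ring }
  have hT : ∀ x, ‖T x‖ = ‖x‖ := fun x => by
    rw [← sq_eq_sq₀ (norm_nonneg _) (norm_nonneg _), EuclideanSpace.norm_sq_eq]
    have h1 := sum_col_sq (m * (unip x * weyl n))
    rw [hval] at h1
    simp only [T, LinearMap.coe_mk, AddHom.coe_mk, Real.norm_eq_abs, sq_abs, mul_pow]
    rw [← Finset.mul_sum, h1]
    linear_combination (‖x‖ ^ 2) * (e * e + 1) * hee
  refine ⟨⟨T, hT⟩, e, he, fun x => ?_⟩
  rw [hval, col_unip_mul_weyl]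
  ext i
  have hT' : ‖(⟨T, hT⟩ : W n →ₗᵢ[ℝ] W n) x‖ = ‖x‖ := hT x
  cases i
  · simp only [Pi.smul_apply, smul_eq_mul, hT']
  · simp [T, ← mul_assoc, hee]
  · simp

theorem intertwining_mul_of_mem_M {t : ℝ} {f : G n → ℂ} (hf : IsEquivariant t f) (g : G n)
    {m : G n} (hm : m ∈ M n) : intertwining f (g * m) = intertwining f g := by
  obtain ⟨T, e, he, hT⟩ := exists_linearIsometry_of_mem_M hm
  have he0 : e ≠ 0 := by rintro rfl; simp at he
  have h : ∀ x : W n, f (g * m * unip x * weyl n) = f (g * unip (T x) * weyl n) := fun x => by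
    rw [hf.eq_of_col (h := g * unip (T x) * weyl n) he0, he, Real.one_rpow, Complex.ofReal_one,
      mul_one]
    rw [mul_assoc, mul_assoc, col_mul, hT, Matrix.mulVec_smul, ← col_mul, mul_assoc]
  simp only [intertwining, h]
  exact (T.toLinearIsometryEquiv rfl).measurePreserving.integral_comp
    (T.toLinearIsometryEquiv rfl).toHomeomorph.measurableEmbedding
    (fun x : W n => f (g * unip x * weyl n))

theorem isEquivariant_intertwining (hn : 2 ≤ n) {t : ℝ} {f : G n → ℂ} (hf : IsEquivariant t f) :
    IsEquivariant (-t) (intertwining f) := fun g m hm a y => by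
  rw [intertwining_mul_unip, intertwining_mul_dia hn hf, intertwining_mul_of_mem_M hf g hm,
    rhoP_rpow]

theorem intertwining_mem_F (hn : 2 ≤ n) {t : ℝ} (ht : 0 < t) {f : G n → ℂ} (hf : f ∈ F n t) :
    intertwining f ∈ F n (-t) :=
  ⟨continuous_intertwining hn ht hf, isEquivariant_intertwining hn hf.2⟩

/-! ### Inversion and invariance -/

theorem abs_det_smul_reflection {E : Type*} [NormedAddCommGroup E] [InnerProductSpace ℝ E]
    [FiniteDimensional ℝ E] (c : ℝ) (hc : 0 ≤ c) (S : Submodule ℝ E) :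
    |((c • (S.reflection : E →L[ℝ] E) : E →L[ℝ] E)).det| = c ^ Module.finrank ℝ E := by
  have h : ((c • (S.reflection : E →L[ℝ] E) : E →L[ℝ] E) : E →ₗ[ℝ] E)
      = c • S.reflection.toLinearMap := rfl
  rw [ContinuousLinearMap.det, h, LinearMap.det_smul, Submodule.det_reflection, abs_mul, abs_pow,
    abs_pow, abs_neg, abs_one, one_pow, mul_one, abs_of_nonneg hc]

theorem inversion_zero_sqrt_two {E : Type*} [NormedAddCommGroup E] [InnerProductSpace ℝ E]
    (x : E) : EuclideanGeometry.inversion (0 : E) (√2) x = (2 / ‖x‖ ^ 2) • x := by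
  rw [EuclideanGeometry.inversion, dist_zero_right, div_pow, Real.sq_sqrt zero_le_two]
  simp

/-- Change of variables along the inversion `x ↦ 2 x / |x|²`. -/
theorem integral_eq_integral_inversion {E F : Type*} [NormedAddCommGroup E]
    [InnerProductSpace ℝ E] [FiniteDimensional ℝ E] [Nontrivial E] [MeasurableSpace E]
    [BorelSpace E] [NormedAddCommGroup F] [NormedSpace ℝ F] (h : E → F) :
    ∫ x, h x = ∫ x, ((2 / ‖x‖ ^ 2) ^ Module.finrank ℝ E) • h ((2 / ‖x‖ ^ 2) • x) := by
  have h2 : (√2 : ℝ) ≠ 0 := by positivity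
  have hinv : Function.Involutive (EuclideanGeometry.inversion (0 : E) (√2)) :=
    EuclideanGeometry.inversion_involutive 0 h2
  have himg : EuclideanGeometry.inversion (0 : E) (√2) '' {0}ᶜ = {0}ᶜ := by
    rw [hinv.image_eq_preimage_symm]
    ext x
    simp [EuclideanGeometry.inversion_eq_center h2]
  have key := integral_image_eq_integral_abs_det_fderiv_smul (volume : Measure E)
    (s := {0}ᶜ) (measurableSet_singleton _).compl
    (fun x hx => (EuclideanGeometry.hasFDerivAt_inversion (R := √2) hx).hasFDerivWithinAt)
    hinv.injective.injOn h
  rw [himg, restrict_compl_singleton] at key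
  rw [key]
  refine integral_congr_ae (Filter.Eventually.of_forall fun x => ?_)
  simp only
  rw [abs_det_smul_reflection _ (by positivity), inversion_zero_sqrt_two, dist_zero_right, div_pow,
    Real.sq_sqrt zero_le_two]

theorem nontrivial_W (hn : 2 ≤ n) : Nontrivial (W n) := by
  apply Module.nontrivial_of_finrank_pos (R := ℝ)
  rw [finrank_euclideanSpace_fin]
  omega

/-- Exchanging the end coordinates of `(|x|²/2, x, 1)` and normalizing the last one to `1` is the
inversion `x ↦ 2x/|x|²`. -/
theorem col_weyl_mul (x : W n) (hx : x ≠ 0) :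
    col (weyl n * (unip x * weyl n))
      = (‖x‖ ^ 2 / 2) • col (unip ((2 / ‖x‖ ^ 2) • x) * weyl n) := by
  have hx' : ‖x‖ ≠ 0 := norm_ne_zero_iff.mpr hx
  rw [col_mul, col_unip_mul_weyl, col_unip_mul_weyl]
  ext i
  rw [mulVec_eq]
  cases i <;> simp [wMat, norm_smul] <;> field_simp

/-- With `c = 2/|x|²`, the inversion has Jacobian `c^(n - 1)` and homogeneity contributes
`c^(-weight n t)`; what remains is the kernel `c^(weight n (-t))`. -/
theorem intertwining_mul_weyl (hn : 2 ≤ n) {t : ℝ} {f : G n → ℂ} (hf : IsEquivariant t f)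
    (g : G n) : intertwining f (g * weyl n) =
      ∫ x : W n, (((2 / ‖x‖ ^ 2) ^ weight n (-t) : ℝ) : ℂ) * f (g * unip x * weyl n) := by
  have := nontrivial_W hn
  rw [intertwining, integral_eq_integral_inversion]
  refine integral_congr_ae ?_
  filter_upwards [compl_mem_ae_iff.mpr (measure_singleton (0 : W n))] with x hx
  have hx0 : x ≠ 0 := hx
  have hx' : 0 < ‖x‖ := norm_pos_iff.mpr hx
  set c : ℝ := 2 / ‖x‖ ^ 2 with hc
  have hc0 : 0 < c := by positivity
  have h1 : ‖c • x‖ ^ 2 / 2 = c := by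
    rw [norm_smul, mul_pow, Real.norm_of_nonneg hc0.le, hc]
    field_simp
  have h2 : (2 / ‖c • x‖ ^ 2) • (c • x) = x := by
    have : 2 / ‖c • x‖ ^ 2 = c⁻¹ := by
      have : ‖c • x‖ ^ 2 = 2 * c := by linarith
      rw [this]
      field_simp
    rw [this, smul_smul, inv_mul_cancel₀ hc0.ne', one_smul]
  have hcx : c • x ≠ 0 := smul_ne_zero hc0.ne' hx0
  have h3 := col_weyl_mul (c • x) hcx
  rw [h2, h1] at h3
  rw [hf.eq_of_col (h := g * unip x * weyl n) hc0.ne', abs_of_pos hc0, finrank_euclideanSpace_fin,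
    Complex.real_smul, mul_left_comm, mul_comm (f _), ← Complex.ofReal_mul, ← Real.rpow_natCast,
    cast_pred hn, ← Real.rpow_add hc0, mul_comm]
  · rw [mul_comm]
    congr 3
    have := weight_add_weight_neg (n := n) t
    linarith
  · rw [mul_assoc, mul_assoc, col_mul, h3, Matrix.mulVec_smul, ← col_mul, mul_assoc]

/-- Since `weight n (-1) = 0`, `I f` depends only on the line of `col g`, and the kernel of
`intertwining_mul_weyl` is trivial. So `I f` is right invariant under `w` and `N`, which carries the
value at `u(x) w` to the value at `1`. -/
theorem intertwining_eq_of_isEquivariant_one (hn : 2 ≤ n) {f : G n → ℂ} (hf : IsEquivariant 1 f)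
    (g : G n) : intertwining f g = intertwining f 1 := by
  have hI := isEquivariant_intertwining hn hf
  have hw : weight n (-1) = 0 := by simp [weight]
  have hcol : ∀ (g h : G n) (a : ℝ), a ≠ 0 → col g = a • col h →
      intertwining f g = intertwining f h := fun g h a ha hgh => by
    rw [hI.eq_of_col ha hgh, hw, neg_zero, Real.rpow_zero, Complex.ofReal_one, mul_one]
  have hweyl : ∀ g, intertwining f (g * weyl n) = intertwining f g := fun g => by
    rw [intertwining_mul_weyl hn hf, hw]
    simp only [Real.rpow_zero, Complex.ofReal_one, one_mul]
    rfl
  by_cases h : col g .last = 0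
  · obtain ⟨h1, h2⟩ := col_eq_smul_of_last_eq_zero g h
    exact hcol _ _ _ h1 h2
  · rw [hcol _ _ _ h (col_eq_smul_of_last_ne_zero g h), hweyl, ← one_mul (unip _),
      intertwining_mul_unip]

instance : SecondCountableTopology (K n) :=
  inferInstanceAs (SecondCountableTopology (K n : Set (G n)))

/-! ### The Haar integral on `K` -/

/-- Compact groups are unimodular: a right translate of Haar measure is again a Haar measure of the
same finite total mass. -/
theorem integral_mul_right_eq_self_of_compact {H : Type*} [TopologicalSpace H] [Group H]
    [IsTopologicalGroup H] [CompactSpace H] [SecondCountableTopology H] [MeasurableSpace H]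
    [BorelSpace H] (μ : Measure H) [μ.IsHaarMeasure] (f : H → ℂ) (h : H) :
    ∫ k, f (k * h) ∂μ = ∫ k, f k ∂μ := by
  have h1 : (μ.map (· * h)).IsHaarMeasure := inferInstance
  have h2 := Measure.isMulInvariant_eq_smul_of_compactSpace (μ.map (· * h)) μ
  have h3 : (μ.map (· * h)) Set.univ = μ Set.univ := by
    rw [Measure.map_apply (measurable_mul_const h) MeasurableSet.univ, Set.preimage_univ]
  have h4 : (Measure.haarScalarFactor (μ.map (· * h)) μ) = 1 := by
    rw [h2, Measure.smul_apply, ENNReal.smul_def, smul_eq_mul] at h3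
    have h5 : μ Set.univ ≠ 0 := (Measure.measure_univ_pos.mpr (NeZero.ne μ)).ne'
    have h6 : μ Set.univ ≠ ⊤ := measure_ne_top _ _
    have h7 := (ENNReal.mul_eq_right h5 h6).mp h3
    exact_mod_cast h7
  rw [h4, one_smul] at h2
  conv_rhs => rw [← h2]
  exact (integral_map_equiv (MeasurableEquiv.mulRight h) f).symm

/-- The integral of `I f` over `K` is computed twice: once with `I f` constant, once by Fubini after
the Iwasawa decomposition of `u(x) w`. Comparison gives `c = vol(K) / ∫ δ`. -/
theorem exists_integral_K_eq (hn : 2 ≤ n) (dk : Measure (K n)) [dk.IsHaarMeasure] :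
    ∃ c : ℝ, 0 < c ∧ ∀ f ∈ F n 1,
      ∫ k : K n, f k ∂dk = c * ∫ x : W n, f (unip x * weyl n) := by
  set δ : W n → ℝ := fun x => (1 + ‖x‖ ^ 2 / 2) ^ (-weight n 1) with hδ
  have hδi : Integrable δ := integrable_rpow_neg_weight hn one_pos
  have hδc : Continuous δ := by
    refine Continuous.rpow_const (by fun_prop) fun x => Or.inl ?_
    positivity
  have hδ0 : ∀ x, 0 < δ x := fun x => by positivity
  have hδI : 0 < ∫ x, δ x :=
    integral_pos_of_integrable_nonneg_nonzero (x := 0) hδc hδi (fun x => (hδ0 x).le) (hδ0 0).ne'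
  have hvol : 0 < dk.real Set.univ := by
    rw [measureReal_def]
    exact ENNReal.toReal_pos (Measure.measure_univ_pos.mpr (NeZero.ne dk)).ne' (measure_ne_top _ _)
  refine ⟨dk.real Set.univ / ∫ x, δ x, div_pos hvol hδI, fun f hf => ?_⟩
  have hfe : IsEquivariant 1 f := hf.2
  have h1 : ∫ k : K n, intertwining f (k : G n) ∂dk
      = dk.real Set.univ * ∫ x : W n, f (unip x * weyl n) := by
    simp only [intertwining_eq_of_isEquivariant_one hn hfe _]
    rw [integral_const, Complex.real_smul]
    simp only [intertwining, one_mul]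
  obtain ⟨C, hC⟩ := isCompact_K.exists_bound_of_continuousOn hf.1.continuousOn
  have h2 : ∫ k : K n, intertwining f (k : G n) ∂dk
      = ((∫ x, δ x : ℝ) : ℂ) * ∫ k : K n, f k ∂dk := by
    -- The factor `reflK x` is absorbed by right invariance of `dk`, leaving only the weight `δ x`.
    simp only [intertwining, hfe.mul_unip_mul_weyl]
    rw [integral_integral_swap]
    · have : ∀ x : W n, ∫ k : K n, f ((k : G n) * (reflK x : G n)) * ((δ x : ℝ) : ℂ) ∂dk
          = ((δ x : ℝ) : ℂ) * ∫ k : K n, f k ∂dk := fun x => by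
        rw [integral_mul_const, mul_comm]
        congr 1
        exact integral_mul_right_eq_self_of_compact dk (fun k : K n => f k) (reflK x)
      refine (integral_congr_ae (Filter.Eventually.of_forall this)).trans ?_
      rw [integral_mul_const, integral_complex_ofReal]
    · have hb : Integrable (fun p : K n × W n => C * δ p.2) (dk.prod volume) :=
        (Integrable.comp_snd hδi dk).const_mul C
      refine hb.mono' ?_ (Filter.Eventually.of_forall fun p => ?_)
      · refine Continuous.aestronglyMeasurable (Continuous.mul (hf.1.comp ?_) ?_)
        · exact (continuous_subtype_val.comp continuous_fst).mul
            (continuous_subtype_val.comp (continuous_reflK.comp continuous_snd))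
        · exact Complex.continuous_ofReal.comp (hδc.comp continuous_snd)
      · rw [Function.uncurry_apply_pair, norm_mul, Complex.norm_real, Real.norm_of_nonneg (hδ0 _).le]
        exact mul_le_mul_of_nonneg_right (hC _ (mul_mem p.1.2 (reflK p.2).2)) (hδ0 _).le
  have h3 : ((∫ x, δ x : ℝ) : ℂ) ≠ 0 := Complex.ofReal_ne_zero.mpr hδI.ne'
  rw [h1] at h2
  rw [Complex.ofReal_div, div_mul_eq_mul_div, h2]
  field_simp

/-- The pairing as a double integral over `W`. -/
theorem exists_pairing_eq (hn : 2 ≤ n) (dk : Measure (K n)) [dk.IsHaarMeasure] :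
    ∃ c : ℝ, 0 < c ∧ ∀ (u : ℝ), 0 < u → ∀ (φ : 𝓢(W n, ℂ)) (f : G n → ℂ), IsSectionOf u φ f →
      pairing dk f (intertwining f) = c * ∫ x : W n, conj (φ x) *
        ∫ y : W n, (((2 / ‖y‖ ^ 2) ^ weight n (-u) : ℝ) : ℂ) * φ (x + y) := by
  obtain ⟨c, hc, h⟩ := exists_integral_K_eq hn dk
  refine ⟨c, hc, fun u hu φ f hf => ?_⟩
  have hI := intertwining_mem_F hn hu hf.1
  -- The weights for `u` and `-u` add up to `n - 1 = weight n 1`.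
  have hmem : (fun g => conj (f g) * intertwining f g) ∈ F n 1 := by
    refine ⟨(Complex.continuous_conj.comp hf.1.1).mul hI.1, fun g m hm a y => ?_⟩
    have ha : 0 < |(a : ℝ)| := abs_pos.mpr a.ne_zero
    simp only
    rw [hf.1.2 g m hm a y, hI.2 g m hm a y, map_mul, Complex.conj_ofReal, mul_mul_mul_comm,
      ← Complex.ofReal_mul, rhoP_rpow, rhoP_rpow, rhoP_rpow, ← Real.rpow_add ha]
    congr 3
    unfold weight
    ring
  rw [pairing, h _ hmem]
  congr 2
  ext x
  rw [hf.2, intertwining_mul_weyl hn hf.1.2]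
  simp only [← unip_add, hf.2]

/-! ### Riesz potentials and the Fourier transform -/

theorem div_norm_sq_rpow {V : Type*} [NormedAddCommGroup V] {c : ℝ} (hc : 0 ≤ c) (w : ℝ) (y : V) :
    (c / ‖y‖ ^ 2) ^ w = c ^ w * ‖y‖ ^ (-(2 * w)) := by
  rw [Real.div_rpow hc (by positivity), ← Real.rpow_natCast, ← Real.rpow_mul (norm_nonneg _),
    Real.rpow_neg (norm_nonneg _), div_eq_mul_inv, Nat.cast_ofNat]

/-- The autocorrelation integrand `conj (φ x) φ (x + y)`. -/
noncomputable def corr {V : Type*} [NormedAddCommGroup V] [InnerProductSpace ℝ V] (φ : 𝓢(V, ℂ)) (p : V × V) : ℂ := conj (φ p.1) * φ (p.1 + p.2)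

theorem continuous_corr {V : Type*} [NormedAddCommGroup V] [InnerProductSpace ℝ V] (φ : 𝓢(V, ℂ)) : Continuous (corr φ) :=
  (Complex.continuous_conj.comp (φ.continuous.comp continuous_fst)).mul
    (φ.continuous.comp (continuous_fst.add continuous_snd))

section Riesz

variable {V : Type*} [NormedAddCommGroup V] [InnerProductSpace ℝ V] [FiniteDimensional ℝ V]
  [MeasurableSpace V] [BorelSpace V]

theorem integrable_mul_norm_rpow_neg [Nontrivial V] {ψ : V → ℝ} (hψc : Continuous ψ)
    (hψi : Integrable ψ) {B : ℝ} (hB : ∀ x, ‖ψ x‖ ≤ B) {a : ℝ} (ha0 : 0 ≤ a)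
    (ha : a < Module.finrank ℝ V) : Integrable fun x => ψ x * ‖x‖ ^ (-a) := by
  have hmeas : AEStronglyMeasurable (fun x : V => ψ x * ‖x‖ ^ (-a)) volume :=
    (hψc.measurable.mul (by fun_prop)).aestronglyMeasurable
  rw [← integrableOn_univ, ← Set.union_compl_self (Metric.ball (0 : V) 1)]
  refine IntegrableOn.union ?_ ?_
  · refine integrableOn_ball_of_norm_le_rpow (C := B) Module.finrank_pos ha
      (Filter.Eventually.of_forall fun x => ?_) hmeas
    have hn : (0 : ℝ) ≤ ‖x‖ ^ (-a) := by positivity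
    rw [norm_mul, Real.norm_of_nonneg hn]
    gcongr
    exact hB x
  · refine hψi.norm.integrableOn.mono' hmeas.restrict ?_
    filter_upwards [ae_restrict_mem (measurableSet_ball.compl)] with x hx
    have hx1 : 1 ≤ ‖x‖ := by simpa using hx
    have hn : (0 : ℝ) ≤ ‖x‖ ^ (-a) := by positivity
    rw [norm_mul, Real.norm_of_nonneg hn]
    exact mul_le_of_le_one_right (norm_nonneg _)
      (Real.rpow_le_one_of_one_le_of_nonpos hx1 (by linarith))

/-- The shear `(x, y) ↦ (x, x + y)` preserves the measure and reduces this to a product of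
integrable functions. -/
theorem integrable_corr (φ : 𝓢(V, ℂ)) : Integrable (corr φ) (volume.prod volume) := by
  have h : Integrable (fun p : V × V => conj (φ p.1) * φ p.2) (volume.prod volume) :=
    Integrable.mul_prod ((Complex.conjLIE.integrable_comp_iff (φ := φ)).mpr φ.integrable)
      φ.integrable
  exact (measurePreserving_prod_add volume volume).integrable_comp_of_integrable h

/-- For `|y| < 1` one factor of `corr` is bounded and `|y|^(-a)` is locally integrable; for `|y| ≥
1` the power is at most `1`. -/
theorem integrable_corr_mul_norm_rpow_neg [Nontrivial V] (φ : 𝓢(V, ℂ)) {a : ℝ} (ha0 : 0 ≤ a)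
    (ha : a < Module.finrank ℝ V) :
    Integrable (fun p : V × V => ‖corr φ p‖ * ‖p.2‖ ^ (-a)) (volume.prod volume) := by
  obtain ⟨B, hB⟩ : ∃ B : ℝ, ∀ x, ‖φ x‖ ≤ B := ⟨_, SchwartzMap.norm_le_seminorm ℝ φ⟩
  have hB0 : 0 ≤ B := (norm_nonneg _).trans (hB 0)
  have h1 : IntegrableOn (fun y : V => B * ‖y‖ ^ (-a)) (Metric.ball 0 1) := by
    refine integrableOn_ball_of_norm_le_rpow (C := B) Module.finrank_pos ha
      (Filter.Eventually.of_forall fun x => ?_)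
      (Measurable.aestronglyMeasurable (by fun_prop))
    rw [Real.norm_of_nonneg (by positivity)]
  have h2 := (Integrable.mul_prod (μ := (volume : Measure V)) φ.integrable.norm
    (h1.integrable_indicator measurableSet_ball)).add (integrable_corr φ).norm
  refine h2.mono' ?_ (Filter.Eventually.of_forall fun p => ?_)
  · exact ((continuous_corr φ).norm.measurable.mul (by fun_prop)).aestronglyMeasurable
  · have hn : (0 : ℝ) ≤ ‖p.2‖ ^ (-a) := by positivity
    rw [Real.norm_of_nonneg (by positivity), Pi.add_apply]
    by_cases hp : p.2 ∈ Metric.ball (0 : V) 1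
    · rw [Set.indicator_of_mem hp]
      have h3 : ‖corr φ p‖ ≤ ‖φ p.1‖ * B := by
        rw [corr, norm_mul, RCLike.norm_conj]
        gcongr
        exact hB _
      have h4 := mul_le_mul_of_nonneg_right h3 hn
      have h5 := norm_nonneg (corr φ p)
      linarith
    · rw [Set.indicator_of_notMem hp, mul_zero, zero_add]
      have hx1 : 1 ≤ ‖p.2‖ := by simpa using hp
      exact mul_le_of_le_one_right (norm_nonneg _)
        (Real.rpow_le_one_of_one_le_of_nonpos hx1 (by linarith))

/-- The Fourier transform is moved from `φ` to the Gaussian modulated by the character of `x`, whose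
transform is a Gaussian centred at `x`. -/
theorem fourierInv_fourier_mul_gaussian (φ : 𝓢(V, ℂ)) {t : ℝ} (ht : 0 < t) (x : V) :
    𝓕⁻ (fun ξ => 𝓕 φ ξ * Complex.exp (-((Real.pi / t : ℝ) : ℂ) * ‖ξ‖ ^ 2)) x
      = ((t ^ ((Module.finrank ℝ V : ℝ) / 2) : ℝ) : ℂ) *
        ∫ y, ((Real.exp (-(Real.pi * ‖y‖ ^ 2 * t)) : ℝ) : ℂ) * φ (x + y) := by
  set b : ℂ := ((Real.pi / t : ℝ) : ℂ) with hb
  have hb0 : 0 < b.re := by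
    rw [hb, Complex.ofReal_re]
    exact div_pos Real.pi_pos ht
  set gx : V → ℂ := fun v => Complex.exp (-b * ‖v‖ ^ 2 + 2 * Real.pi * Complex.I * inner ℝ x v)
    with hgx
  have hgi : Integrable gx := GaussianFourier.integrable_cexp_neg_mul_sq_norm_add hb0 _ x
  have h1 : 𝓕⁻ (fun ξ => 𝓕 φ ξ * Complex.exp (-b * ‖ξ‖ ^ 2)) x = ∫ ξ, 𝓕 (φ : V → ℂ) ξ • gx ξ := by
    rw [Real.fourierInv_eq']
    congr 1
    ext ξ
    rw [SchwartzMap.fourier_coe, smul_eq_mul, smul_eq_mul, hgx, mul_left_comm, ← Complex.exp_add,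
      real_inner_comm]
    congr 2
    push_cast
    ring
  have h2 : ∫ ξ, 𝓕 (φ : V → ℂ) ξ • gx ξ = ∫ z, φ z • 𝓕 gx z := by
    simpa using! VectorFourier.integral_fourierIntegral_smul_eq_flip (L := innerₗ V)
      Real.continuous_fourierChar continuous_inner φ.integrable hgi
  have hpb : (Real.pi : ℂ) / b = (t : ℂ) := by
    have := Real.pi_ne_zero
    rw [hb, ← Complex.ofReal_div]
    congr 1
    field_simp
  rw [h1, h2, ← integral_add_left_eq_self _ x, ← integral_const_mul]
  congr 1
  ext y
  rw [hgx, fourier_gaussian_innerProductSpace' hb0, hpb, smul_eq_mul, mul_comm (φ _), mul_assoc]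
  congr 1
  · rw [Complex.ofReal_cpow ht.le]
    push_cast
    rfl
  · congr 1
    rw [Complex.ofReal_exp]
    congr 1
    have e : x - (x + y) = -y := by abel
    have : -(Real.pi : ℂ) ^ 2 * (‖x - (x + y)‖ : ℂ) ^ 2 / b
        = -(Real.pi * ‖y‖ ^ 2 * (Real.pi / b)) := by
      rw [e, norm_neg]
      ring
    rw [this, hpb]
    push_cast
    ring

/-- Parseval's formula for the convolution with a Gaussian. -/
theorem integral_corr_gaussian (φ : 𝓢(V, ℂ)) {t : ℝ} (ht : 0 < t) :
    ∫ p : V × V, corr φ p * ((Real.exp (-(Real.pi * ‖p.2‖ ^ 2 * t)) : ℝ) : ℂ)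
        ∂(volume.prod volume)
      = ((t ^ (-((Module.finrank ℝ V : ℝ) / 2)) *
        ∫ ξ, ‖𝓕 (φ : V → ℂ) ξ‖ ^ 2 * Real.exp (-(Real.pi * ‖ξ‖ ^ 2 * t⁻¹)) : ℝ) : ℂ) := by
  have hint : Integrable (fun p : V × V =>
      corr φ p * ((Real.exp (-(Real.pi * ‖p.2‖ ^ 2 * t)) : ℝ) : ℂ)) (volume.prod volume) := by
    refine (integrable_corr φ).norm.mono' ?_ (Filter.Eventually.of_forall fun p => ?_)
    · exact ((continuous_corr φ).mul (by fun_prop)).aestronglyMeasurable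
    · rw [norm_mul, Complex.norm_real, Real.norm_of_nonneg (Real.exp_nonneg _)]
      refine mul_le_of_le_one_right (norm_nonneg _) (Real.exp_le_one_iff.mpr ?_)
      have := Real.pi_pos
      have : 0 ≤ Real.pi * ‖p.2‖ ^ 2 * t := by positivity
      linarith
  set g : V → ℂ := fun ξ => 𝓕 φ ξ * Complex.exp (-((Real.pi / t : ℝ) : ℂ) * ‖ξ‖ ^ 2) with hg
  have hgnorm : ∀ ξ : V, Complex.exp (-((Real.pi / t : ℝ) : ℂ) * ‖ξ‖ ^ 2)
      = ((Real.exp (-(Real.pi * ‖ξ‖ ^ 2 * t⁻¹)) : ℝ) : ℂ) := fun ξ => by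
    rw [Complex.ofReal_exp]
    congr 1
    push_cast
    ring
  have hgi : Integrable g := by
    refine (𝓕 φ).integrable.norm.mono' ?_ (Filter.Eventually.of_forall fun ξ => ?_)
    · exact ((𝓕 φ).continuous.mul (by fun_prop)).aestronglyMeasurable
    · rw [hg]
      simp only
      rw [norm_mul, hgnorm, Complex.norm_real, Real.norm_of_nonneg (Real.exp_nonneg _)]
      refine mul_le_of_le_one_right (norm_nonneg _) (Real.exp_le_one_iff.mpr ?_)
      have := Real.pi_pos
      have : 0 ≤ Real.pi * ‖ξ‖ ^ 2 * t⁻¹ := by positivity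
      linarith
  -- Sesquilinear Parseval, pairing `𝓕 φ` with `g` and `φ` with `𝓕⁻ g`.
  have h1 : ∫ ξ, innerSL ℂ (𝓕 (φ : V → ℂ) ξ) (g ξ) = ∫ x, innerSL ℂ (φ x) (𝓕⁻ g x) := by
    simpa using! VectorFourier.integral_sesq_fourierIntegral_eq_neg_flip (innerSL ℂ)
      (L := innerₗ V) Real.continuous_fourierChar continuous_inner φ.integrable hgi
  have ht' : t ^ (-((Module.finrank ℝ V : ℝ) / 2)) * t ^ ((Module.finrank ℝ V : ℝ) / 2) = 1 := by
    rw [← Real.rpow_add ht, neg_add_cancel, Real.rpow_zero]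
  calc _ = ∫ x, ∫ y, corr φ (x, y) * ((Real.exp (-(Real.pi * ‖y‖ ^ 2 * t)) : ℝ) : ℂ) :=
        integral_prod _ hint
    _ = ∫ x, ((t ^ (-((Module.finrank ℝ V : ℝ) / 2)) : ℝ) : ℂ) *
          innerSL ℂ (φ x) (𝓕⁻ g x) := by
        congr 1
        ext x
        rw [hg, fourierInv_fourier_mul_gaussian φ ht, innerSL_apply_apply, RCLike.inner_apply,
          mul_comm _ (conj _), mul_left_comm _ (Complex.ofReal _), ← mul_assoc, ← Complex.ofReal_mul,
          ht', Complex.ofReal_one, one_mul, ← integral_const_mul]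
        congr 1
        ext y
        rw [corr]
        ring
    _ = ((t ^ (-((Module.finrank ℝ V : ℝ) / 2)) : ℝ) : ℂ) *
          ∫ ξ, innerSL ℂ (𝓕 (φ : V → ℂ) ξ) (g ξ) := by
        rw [h1, integral_const_mul]
    _ = _ := by
        rw [Complex.ofReal_mul, ← integral_complex_ofReal]
        congr 2
        ext ξ
        rw [innerSL_apply_apply, RCLike.inner_apply, hg]
        simp only
        rw [hgnorm, mul_right_comm, SchwartzMap.fourier_coe, Complex.mul_conj, Complex.normSq_eq_norm_sq,
          ← Complex.ofReal_mul]

/-- The Gamma integral after `t ↦ t⁻¹`; the inverse appears because the Fourier transform inverts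
the width of a Gaussian. -/
theorem integral_rpow_mul_exp_neg_inv {a r : ℝ} (ha : 0 < a) (hr : 0 < r) :
    ∫ t in Set.Ioi (0 : ℝ), t ^ (-a - 1) * Real.exp (-(r * t⁻¹)) = (1 / r) ^ a * Real.Gamma a := by
  rw [← Real.integral_rpow_mul_exp_neg_mul_Ioi ha hr,
    ← integral_comp_rpow_Ioi _ (show (-1 : ℝ) ≠ 0 by norm_num)]
  refine setIntegral_congr_fun measurableSet_Ioi fun t ht => ?_
  have ht' : (0 : ℝ) < t := ht
  simp only [abs_neg, abs_one, one_mul, smul_eq_mul, Real.rpow_neg_one]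
  rw [← mul_assoc, Real.inv_rpow ht'.le, ← Real.rpow_neg ht'.le, ← Real.rpow_add ht',
    inv_inv]
  congr 2
  ring

/-- The weak form of the statement that the Fourier transform of `|y|^{-2w}` is a multiple of
`|ξ|^{2w-d}`. -/
theorem exists_integral_corr_riesz [Nontrivial V] {w : ℝ} (hw : 0 < w)
    (hwd : 2 * w < Module.finrank ℝ V) :
    ∃ c : ℝ, 0 < c ∧ ∀ φ : 𝓢(V, ℂ),
      Integrable (fun ξ : V => ‖𝓕 (φ : V → ℂ) ξ‖ ^ 2 / ‖ξ‖ ^ ((Module.finrank ℝ V : ℝ) - 2 * w)) ∧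
      ∫ p : V × V, corr φ p * ((‖p.2‖ ^ (-(2 * w)) : ℝ) : ℂ) ∂(volume.prod volume)
        = ((c * ∫ ξ : V, ‖𝓕 (φ : V → ℂ) ξ‖ ^ 2 /
            ‖ξ‖ ^ ((Module.finrank ℝ V : ℝ) - 2 * w) : ℝ) : ℂ) := by
  set d : ℝ := ((Module.finrank ℝ V : ℕ) : ℝ) with hd
  -- The dual exponent: Parseval contributes `t^(-d/2)`, and `t^(w - 1) t^(-d/2) = t^(-w' - 1)`.
  set w' : ℝ := d / 2 - w with hw'
  have hw'0 : 0 < w' := by rw [hw']; linarith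
  have hpi := Real.pi_pos
  have hG := Real.Gamma_pos_of_pos hw
  have hG' := Real.Gamma_pos_of_pos hw'0
  set c₁ : ℝ := (1 / Real.pi) ^ w * Real.Gamma w with hc₁
  set c₂ : ℝ := (1 / Real.pi) ^ w' * Real.Gamma w' with hc₂
  have hc₁0 : 0 < c₁ := by positivity
  have hc₂0 : 0 < c₂ := by positivity
  have hk₁ : ∀ y : V, y ≠ 0 →
      ∫ t in Set.Ioi (0 : ℝ), t ^ (w - 1) * Real.exp (-(Real.pi * ‖y‖ ^ 2 * t))
        = c₁ * ‖y‖ ^ (-(2 * w)) := fun y hy => by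
    have hy' : 0 < ‖y‖ := norm_pos_iff.mpr hy
    rw [Real.integral_rpow_mul_exp_neg_mul_Ioi hw (by positivity), ← div_div,
      div_norm_sq_rpow (by positivity), hc₁]
    ring
  have hk₂ : ∀ y : V, y ≠ 0 →
      ∫ t in Set.Ioi (0 : ℝ), t ^ (-w' - 1) * Real.exp (-(Real.pi * ‖y‖ ^ 2 * t⁻¹))
        = c₂ * ‖y‖ ^ (-(2 * w')) := fun y hy => by
    have hy' : 0 < ‖y‖ := norm_pos_iff.mpr hy
    rw [integral_rpow_mul_exp_neg_inv hw'0 (by positivity), ← div_div,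
      div_norm_sq_rpow (by positivity), hc₂]
    ring
  clear_value c₁ c₂
  -- A non-integrable function has integral `0` by convention, so the nonzero value in `hk₁` already
  -- proves integrability; likewise for `hi₂`.
  have hi₁ : ∀ y : V, y ≠ 0 → IntegrableOn
      (fun t : ℝ => t ^ (w - 1) * Real.exp (-(Real.pi * ‖y‖ ^ 2 * t))) (Set.Ioi 0) := fun y hy => by
    have hy' : 0 < ‖y‖ := norm_pos_iff.mpr hy
    refine not_imp_comm.mp integral_undef ?_
    rw [hk₁ y hy]
    positivity
  have hi₂ : ∀ y : V, y ≠ 0 → IntegrableOn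
      (fun t : ℝ => t ^ (-w' - 1) * Real.exp (-(Real.pi * ‖y‖ ^ 2 * t⁻¹))) (Set.Ioi 0) :=
    fun y hy => by
    have hy' : 0 < ‖y‖ := norm_pos_iff.mpr hy
    refine not_imp_comm.mp integral_undef ?_
    rw [hk₂ y hy]
    positivity
  have hae : ∀ᵐ y : V, y ≠ 0 := compl_mem_ae_iff.mpr (measure_singleton (0 : V))
  have hae' : ∀ᵐ p : V × V ∂(volume.prod volume), p.2 ≠ 0 :=
    Measure.quasiMeasurePreserving_snd.ae hae
  refine ⟨c₂ / c₁, by positivity, fun φ => ?_⟩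
  set N : V → ℝ := fun ξ => ‖𝓕 (φ : V → ℂ) ξ‖ ^ 2 with hN
  have hNc : Continuous N := (𝓕 φ).continuous.norm.pow 2
  have hNi : Integrable (fun ξ => N ξ * ‖ξ‖ ^ (-(2 * w'))) := by
    obtain ⟨B, hB⟩ : ∃ B : ℝ, ∀ x, ‖𝓕 φ x‖ ≤ B := ⟨_, SchwartzMap.norm_le_seminorm ℝ (𝓕 φ)⟩
    have hB0 : 0 ≤ B := (norm_nonneg _).trans (hB 0)
    have hNB : ∀ x, ‖N x‖ ≤ B * ‖𝓕 φ x‖ := fun x => by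
      rw [Real.norm_of_nonneg (by positivity)]
      change ‖𝓕 φ x‖ ^ 2 ≤ _
      rw [pow_two]
      exact mul_le_mul_of_nonneg_right (hB x) (norm_nonneg _)
    refine integrable_mul_norm_rpow_neg (B := B * B) hNc ?_ (fun x => ?_) (by linarith) (by linarith)
    · exact ((𝓕 φ).integrable.norm.const_mul B).mono' hNc.aestronglyMeasurable
        (Filter.Eventually.of_forall hNB)
    · exact (hNB x).trans (by gcongr; exact hB x)
  have hdiv : ∀ ξ : V, N ξ / ‖ξ‖ ^ (d - 2 * w) = N ξ * ‖ξ‖ ^ (-(2 * w')) := fun ξ => by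
    rw [div_eq_mul_inv, ← Real.rpow_neg (norm_nonneg _)]
    congr 3
    rw [hw']
    ring
  have hT₁ : Integrable (fun q : (V × V) × ℝ => corr φ q.1 *
      ((q.2 ^ (w - 1) * Real.exp (-(Real.pi * ‖q.1.2‖ ^ 2 * q.2)) : ℝ) : ℂ))
      ((volume.prod volume).prod (volume.restrict (Set.Ioi 0))) := by
    rw [integrable_prod_iff]
    · refine ⟨?_, ?_⟩
      · filter_upwards [hae'] with p hp
        exact (hi₁ p.2 hp).ofReal.const_mul _
      · refine ((integrable_corr_mul_norm_rpow_neg φ (by linarith) hwd).const_mul c₁).congr ?_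
        filter_upwards [hae'] with p hp
        rw [mul_left_comm, ← hk₁ p.2 hp, ← integral_const_mul]
        refine setIntegral_congr_fun measurableSet_Ioi fun t ht => ?_
        have ht' : (0 : ℝ) < t := ht
        rw [norm_mul, Complex.norm_real, Real.norm_of_nonneg (by positivity)]
    · refine AEStronglyMeasurable.mul ?_ ?_
      · exact ((continuous_corr φ).comp continuous_fst).aestronglyMeasurable
      · refine (Complex.measurable_ofReal.comp ?_).aestronglyMeasurable
        fun_prop
  have hT₂ : Integrable (fun q : V × ℝ => N q.1 *
      (q.2 ^ (-w' - 1) * Real.exp (-(Real.pi * ‖q.1‖ ^ 2 * q.2⁻¹))))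
      (volume.prod (volume.restrict (Set.Ioi 0))) := by
    rw [integrable_prod_iff]
    · refine ⟨?_, ?_⟩
      · filter_upwards [hae] with p hp
        exact (hi₂ p hp).const_mul _
      · refine (hNi.const_mul c₂).congr ?_
        filter_upwards [hae] with p hp
        rw [mul_left_comm, ← hk₂ p hp, ← integral_const_mul]
        refine setIntegral_congr_fun measurableSet_Ioi fun t ht => ?_
        have ht' : (0 : ℝ) < t := ht
        rw [Real.norm_of_nonneg (by positivity)]
    · refine AEStronglyMeasurable.mul ?_ ?_
      · exact (hNc.comp continuous_fst).aestronglyMeasurable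
      · refine Measurable.aestronglyMeasurable ?_
        fun_prop
  refine ⟨hNi.congr (Filter.Eventually.of_forall fun ξ => (hdiv ξ).symm), ?_⟩
  have e₁ : (c₁ : ℂ) * ∫ p : V × V, corr φ p * ((‖p.2‖ ^ (-(2 * w)) : ℝ) : ℂ) ∂(volume.prod volume)
      = ∫ p : V × V, (∫ t in Set.Ioi (0 : ℝ), corr φ p *
        ((t ^ (w - 1) * Real.exp (-(Real.pi * ‖p.2‖ ^ 2 * t)) : ℝ) : ℂ)) ∂(volume.prod volume) := by
    rw [← integral_const_mul]
    refine integral_congr_ae ?_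
    filter_upwards [hae'] with p hp
    rw [integral_const_mul, integral_complex_ofReal, hk₁ p.2 hp, Complex.ofReal_mul]
    ring
  have e₂ : ∫ t in Set.Ioi (0 : ℝ), (∫ ξ, N ξ *
        (t ^ (-w' - 1) * Real.exp (-(Real.pi * ‖ξ‖ ^ 2 * t⁻¹))))
      = c₂ * ∫ ξ : V, N ξ * ‖ξ‖ ^ (-(2 * w')) := by
    rw [← integral_integral_swap hT₂, ← integral_const_mul]
    refine integral_congr_ae ?_
    filter_upwards [hae] with p hp
    rw [integral_const_mul, hk₂ p hp]
    ring
  have e₃ : ∫ p : V × V, (∫ t in Set.Ioi (0 : ℝ), corr φ p *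
        ((t ^ (w - 1) * Real.exp (-(Real.pi * ‖p.2‖ ^ 2 * t)) : ℝ) : ℂ)) ∂(volume.prod volume)
      = ((∫ t in Set.Ioi (0 : ℝ), (∫ ξ, N ξ *
        (t ^ (-w' - 1) * Real.exp (-(Real.pi * ‖ξ‖ ^ 2 * t⁻¹)))) : ℝ) : ℂ) := by
    rw [integral_integral_swap hT₁, ← integral_complex_ofReal]
    refine setIntegral_congr_fun measurableSet_Ioi fun t ht => ?_
    have ht' : (0 : ℝ) < t := ht
    have e₄ : ∫ p : V × V, corr φ p *
        ((t ^ (w - 1) * Real.exp (-(Real.pi * ‖p.2‖ ^ 2 * t)) : ℝ) : ℂ) ∂(volume.prod volume)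
        = ((t ^ (w - 1) : ℝ) : ℂ) * ∫ p : V × V, corr φ p *
          ((Real.exp (-(Real.pi * ‖p.2‖ ^ 2 * t)) : ℝ) : ℂ) ∂(volume.prod volume) := by
      rw [← integral_const_mul]
      congr 1
      ext p
      push_cast
      ring
    rw [e₄, integral_corr_gaussian φ ht', ← Complex.ofReal_mul, ← mul_assoc, ← Real.rpow_add ht',
      ← integral_const_mul]
    congr 2
    ext ξ
    have hexp : w - 1 + -(((Module.finrank ℝ V : ℕ) : ℝ) / 2) = -w' - 1 := by
      rw [hw', hd]
      ring
    rw [hexp, mul_left_comm]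
  have hfin : ∫ ξ : V, N ξ / ‖ξ‖ ^ (d - 2 * w) = ∫ ξ : V, N ξ * ‖ξ‖ ^ (-(2 * w')) := by
    simp only [hdiv]
  rw [hfin, div_mul_eq_mul_div, ← e₂, Complex.ofReal_div, ← e₃, ← e₁]
  have : (c₁ : ℂ) ≠ 0 := Complex.ofReal_ne_zero.mpr hc₁0.ne'
  field_simp

end Riesz

/-! ### Positivity, exponents, and the main theorem -/

theorem fourier_norm_sq_integral_pos {V : Type*} [NormedAddCommGroup V] [InnerProductSpace ℝ V]
    [FiniteDimensional ℝ V] [MeasurableSpace V] [BorelSpace V] [Nontrivial V] {φ : 𝓢(V, ℂ)}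
    (hφ : φ ≠ 0) {a : ℝ}
    (hi : Integrable (fun ξ : V => ‖𝓕 (φ : V → ℂ) ξ‖ ^ 2 / ‖ξ‖ ^ a)) :
    0 < ∫ ξ : V, ‖𝓕 (φ : V → ℂ) ξ‖ ^ 2 / ‖ξ‖ ^ a := by
  have hc : Continuous (𝓕 (φ : V → ℂ)) := (𝓕 φ).continuous
  have hne : 𝓕 φ ≠ 0 := fun h => hφ (by
    apply (FourierTransform.fourierCLE ℂ 𝓢(V, ℂ)).injective
    rw [map_zero]
    exact h)
  obtain ⟨ξ₀, hξ₀⟩ : ∃ ξ, 𝓕 (φ : V → ℂ) ξ ≠ 0 := by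
    by_contra! h
    exact hne (SchwartzMap.ext h)
  rw [integral_pos_iff_support_of_nonneg (fun ξ => by positivity) hi]
  have hopen : IsOpen {ξ | 𝓕 (φ : V → ℂ) ξ ≠ 0} := isOpen_ne_fun hc continuous_const
  -- The origin is removed because the quotient there may be `0` by the convention for division by
  -- zero.
  have hpos : 0 < volume ({ξ | 𝓕 (φ : V → ℂ) ξ ≠ 0} \ {0}) := by
    rw [measure_sdiff_null (measure_singleton 0)]
    exact hopen.measure_pos volume ⟨ξ₀, hξ₀⟩
  refine hpos.trans_le (measure_mono ?_)
  rintro ξ ⟨h1, h2⟩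
  have h3 : 0 < ‖ξ‖ := norm_pos_iff.mpr h2
  have h4 : 0 < ‖𝓕 (φ : V → ℂ) ξ‖ := norm_pos_iff.mpr h1
  exact (by positivity : (0 : ℝ) < ‖𝓕 (φ : V → ℂ) ξ‖ ^ 2 / ‖ξ‖ ^ a).ne'

/-- Here `2 * weight n (-u) = (1 - u)(n - 1)`: positivity needs `u < 1`, and local integrability of
the kernel needs `u > 0`. -/
theorem weight_neg_bounds (hn : 2 ≤ n) {u : ℝ} (hu0 : 0 < u) (hu1 : u < 1) :
    0 < weight n (-u) ∧ 2 * weight n (-u) < ((n - 1 : ℕ) : ℝ) ∧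
      ((n - 1 : ℕ) : ℝ) - 2 * weight n (-u) = ((n : ℝ) - 1) * u := by
  have h2 : (2 : ℝ) ≤ n := by exact_mod_cast hn
  rw [cast_pred hn]
  unfold weight
  refine ⟨?_, ?_, ?_⟩ <;> nlinarith

end ComplementarySeries

open ComplementarySeries in
theorem mainTheorem5 (n : ℕ) (hn : 2 ≤ n) (dk : Measure (K n)) [dk.IsHaarMeasure]
    (u : ℝ) (hu0 : 0 < u) (hu1 : u < 1) :
    (∀ φ : 𝓢(W n, ℂ), ∃! f : G n → ℂ, IsSectionOf u φ f) ∧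
    ∃ c : ℝ, 0 < c ∧ ∀ (φ : 𝓢(W n, ℂ)) (f : G n → ℂ), IsSectionOf u φ f →
      (∀ g : G n, Integrable (fun x : W n => f (g * unip x * weyl n))) ∧
      intertwining f ∈ F n (-u) ∧
      Integrable (fun x : W n => ‖𝓕 (φ : W n → ℂ) x‖ ^ 2 / ‖x‖ ^ (((n : ℝ) - 1) * u)) ∧
      pairing dk f (intertwining f) =
        ((c * ∫ x : W n, ‖𝓕 (φ : W n → ℂ) x‖ ^ 2 / ‖x‖ ^ (((n : ℝ) - 1) * u) : ℝ) : ℂ) ∧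
      (φ ≠ 0 → 0 < (pairing dk f (intertwining f)).re ∧
        (pairing dk f (intertwining f)).im = 0) := by
  have := nontrivial_W hn
  refine ⟨fun φ => ⟨_, isSectionOf_coneExtension hn hu0 φ, fun f hf =>
    hf.unique hn (isSectionOf_coneExtension hn hu0 φ)⟩, ?_⟩
  obtain ⟨hw0, hwd, hexp⟩ := weight_neg_bounds hn hu0 hu1
  set w := weight n (-u) with hw
  obtain ⟨c₁, hc₁, h₁⟩ := exists_pairing_eq hn dk
  have hfr : ((Module.finrank ℝ (W n) : ℕ) : ℝ) = ((n - 1 : ℕ) : ℝ) := by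
    rw [finrank_euclideanSpace_fin]
  obtain ⟨c₂, hc₂, h₂⟩ := exists_integral_corr_riesz (V := W n) hw0 (by rwa [hfr])
  rw [hfr, hexp] at h₂
  have hc : 0 < c₁ * 2 ^ w * c₂ := by positivity
  -- The factors come from passing from `K` to `W`, from the `2` in the inversion kernel, and from
  -- the Fourier transform of the Riesz kernel.
  refine ⟨c₁ * 2 ^ w * c₂, hc, fun φ f hf => ?_⟩
  obtain ⟨hi, hcorr⟩ := h₂ φ
  have hpair : pairing dk f (intertwining f) = ((c₁ * 2 ^ w * c₂ *
      ∫ x : W n, ‖𝓕 (φ : W n → ℂ) x‖ ^ 2 / ‖x‖ ^ (((n : ℝ) - 1) * u) : ℝ) : ℂ) := by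
    have hint : Integrable (fun p : W n × W n =>
        corr φ p * ((‖p.2‖ ^ (-(2 * w)) : ℝ) : ℂ)) (volume.prod volume) := by
      refine (integrable_corr_mul_norm_rpow_neg φ (a := 2 * w) (by linarith)
        (by rwa [hfr])).mono' ?_ (Filter.Eventually.of_forall fun p => ?_)
      · exact (continuous_corr φ).aestronglyMeasurable.mul
          (Complex.measurable_ofReal.comp (by fun_prop)).aestronglyMeasurable
      · rw [norm_mul, Complex.norm_real, Real.norm_of_nonneg (by positivity)]
    rw [h₁ u hu0 φ f hf, ← hw, mul_assoc, mul_assoc, Complex.ofReal_mul c₁,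
      Complex.ofReal_mul (2 ^ w), ← hcorr, integral_prod _ hint]
    congr 1
    rw [← integral_const_mul]
    congr 1
    ext x
    rw [← integral_const_mul, ← integral_const_mul]
    congr 1
    ext y
    rw [div_norm_sq_rpow zero_le_two, corr, Complex.ofReal_mul]
    ring
  refine ⟨integrable_integrand hn hu0 hf.1, intertwining_mem_F hn hu0 hf.1, hi, hpair,
    fun hφ => ?_⟩
  rw [hpair]
  exact ⟨by rw [Complex.ofReal_re]; exact mul_pos hc (fourier_norm_sq_integral_pos hφ hi),
    Complex.ofReal_im _⟩
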